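/- Let $q,b_1,b_2,b_3,b_4,b_6,t\in\mathbb C$ with $0<|q|<1$, $b_1b_2b_3b_4=1$, $b_6\ne0$, $t\neq 0$. Put $\Delta y(x)=(q-1)x$, $$D_xF(x)=\frac{F(qx)-F(x)}{(q-1)x},\qquad M_xF(x)=\tfrac12\,[F(qx)+F(x)],$$ and let $$w(x)=\frac{(b_2x,\;b_3x,\;b_6^{-1}xt^{-1};q)_\infty}{(b_1x,\;b_4x,\;b_6xt^{-1};q)_\infty}$$ be the deformed big $q$-Jacobi weight. Its spectral polynomials $W,V$ are given by $W+\Delta y\,V=b_6(1-b_1x)(1-b_4x)(t-b_6x)$ and $W-\Delta y\,V=(1-b_2x)(1-b_3x)(b_6t-x)$. Let $\alpha,\beta$ be zeros of $w$ such that $w$ has no pole at any $\alpha q^k,\beta q^k$ ($k\ge0$), and let $\int_\alpha^\beta d_qx$ denote the Thomae–Jackson $q$-integral $\int_\alpha^\beta f\,d_qx=(1-q)\beta\sum_{k\ge0}q^kf(\beta q^k)-(1-q)\alpha\sum_{k\ge0}q^kf(\alpha q^k)$. Suppose $(p_n)_{n\ge0}$, $\deg p_n=n$, is an orthonormal polynomial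 system: $\int_\alpha^\beta w\,p_mp_n\,d_qx=\delta_{mn}$. Let $\gamma_n$ be the leading coefficient of $p_n$, let $a_n=\gamma_{n-1}/\gamma_n$ for $n\ge1$ (the off-diagonal coefficient in $a_{n+1}p_{n+1}=(x-b_n)p_n-a_np_{n-1}$, where here $b_n$ denotes the diagonal recurrence coefficient), let $a_0\neq0$ be any constant, and let $$q_n(x)=\int_\alpha^\beta \frac{w(y)p_n(y)}{x-y}\,d_qy\quad(n\ge 0),\qquad p_{-1}=0,\qquad q_{-1}=\frac1{a_0\gamma_0},\qquad Y_n=\begin{pmatrix}p_n&q_n/w\\ p_{n-1}&q_{n-1}/w\end{pmatrix}.$$ The spectral coefficients are polynomials $W_n\not\equiv0$, $\Omega_n$, $\Theta_n$ ($n\ge0$; $\Theta_{-1}:=0$) such that for all $n\ge0$ $$D_xY_n=\frac1{W_n}\begin{pmatrix}\Omega_n&-a_n\Theta_n\\ a_n\Theta_{n-1}&-\Omega_n-2V\end{pmatrix}M_xY_n$$ at every $x\ne0$ such that neither $x$ nor $qx$ is a zero or a pole of $w$ or one of the points $\alpha q^k,\beta q^k$ ($k\ge0$), and such that $W_n(x)\neq0$.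 Such spectral coefficients exist. Moreover, for any spectral coefficients the following holds. Let $n\ge0$, define $b_5$ by $q^n=b_5/(b_1b_4b_6)$, and assume $b_5^2\ne1$ and $qb_5^2\neq1$. Then $\Theta_n$ has exactly one zero $\lambda_n$ in $\mathbb C$, and $$\Theta_n=-\frac{b_6(1-qb_5^2)}{q(1-q)b_5}\,(x-\lambda_n).$$ With $\nu_n=(2W_n-W)(\lambda_n)$ and $\mu_n=(\Omega_n+V)(\lambda_n)$ one has $$\nu_n^2=(1-q)^2\lambda_n^2\mu_n^2+b_6(b_1\lambda_n-1)(b_2\lambda_n-1)(b_3\lambda_n-1)(b_4\lambda_n-1)(\lambda_n-b_6t)(b_6\lambda_n-t),$$ and, if $\lambda_n\ne0$, $$2W_n-W=x^2\frac{\nu_n}{\lambda_n^2}+\tfrac12(x-\lambda_n)\Big[-b_6(b_5+b_5^{-1})x^2+\frac{1+(b_1+b_2+b_3+b_4)b_6t+b_6^2}{\lambda_n}\,x-2tb_6\frac{x+\lambda_n}{\lambda_n^2}\Big],$$ $$\begin{aligned}\Omega_n+V=\mu_n+\frac{b_6\,(x-\lambda_n)}{2b_5(1-q)(1-b_5^2)\lambda_n^2}\Big\{&-(1-b_5^2)^2\lambda_n^2x-2b_5^2\big[b_1^{-1}+b_2^{-1}+b_3^{-1}+b_4^{-1}+(b_6+b_6^{-1})t-2\lambda_n\big]\lambda_n^2\\&+b_5b_6^{-1}(1+b_5^2)\big[(1+(b_1+b_2+b_3+b_4)b_6t+b_6^2)\lambda_n+2\nu_n-2tb_6\big]\Big\}.\end{aligned}$$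 -/

import Mathlib

open Polynomial

noncomputable section

namespace DeformedBigQJacobi

/-- The numerical data: the base `q`, the weight parameters and the deformation variable `t`. -/
structure Params where
  q : ℂ
  b₁ : ℂ
  b₂ : ℂ
  b₃ : ℂ
  b₄ : ℂ
  b₆ : ℂ
  t : ℂ

/-- The divided-difference operator of the `q`-linear lattice `ι₊ x = q x`, `ι₋ x = x`. -/
def dividedDiff (q : ℂ) (F : ℂ → Matrix (Fin 2) (Fin 2) ℂ) (x : ℂ) : Matrix (Fin 2) (Fin 2) ℂ :=
  (q * x - x)⁻¹ • (F (q * x) - F x)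

/-- The companion mean operator. -/
def mean (q : ℂ) (F : ℂ → Matrix (Fin 2) (Fin 2) ℂ) (x : ℂ) : Matrix (Fin 2) (Fin 2) ℂ :=
  (2 : ℂ)⁻¹ • (F (q * x) + F x)

/-- The infinite `q`-shifted factorial `(a; q)_∞`. -/
def qShifted (q a : ℂ) : ℂ := ∏' j : ℕ, (1 - a * q ^ j)

/-- The Thomae-Jackson integral of `f` from `α` to `β`. -/
def jackson (q α β : ℂ) (f : ℂ → ℂ) : ℂ :=
  (1 - q) * β * ∑' k : ℕ, q ^ k * f (β * q ^ k) - (1 - q) * α * ∑' k : ℕ, q ^ k * f (α * q ^ k)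

/-- The points at which `jackson q α β` samples its integrand. -/
def support (q α β : ℂ) : Set ℂ := {y | ∃ k : ℕ, y = α * q ^ k ∨ y = β * q ^ k}

namespace Params

variable (P : Params)

/-- Numerator of the deformed big `q`-Jacobi weight. -/
def weightNum (x : ℂ) : ℂ :=
  qShifted P.q (P.b₂ * x) * qShifted P.q (P.b₃ * x) * qShifted P.q (P.b₆⁻¹ * x * P.t⁻¹)

/-- Denominator of the deformed big `q`-Jacobi weight. -/
def weightDen (x : ℂ) : ℂ :=
  qShifted P.q (P.b₁ * x) * qShifted P.q (P.b₄ * x) * qShifted P.q (P.b₆ * x * P.t⁻¹)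

/-- The deformed big `q`-Jacobi weight. -/
def weight (x : ℂ) : ℂ := P.weightNum x / P.weightDen x

/-- The polynomial `W + Δy V`. -/
def specPlus : ℂ[X] :=
  C P.b₆ * (1 - C P.b₁ * X) * (1 - C P.b₄ * X) * (C P.t - C P.b₆ * X)

/-- The polynomial `W - Δy V`. -/
def specMinus : ℂ[X] :=
  (1 - C P.b₂ * X) * (1 - C P.b₃ * X) * (C (P.b₆ * P.t) - X)

/-- The spectral polynomial `W`. -/
def W : ℂ[X] := C (2⁻¹ : ℂ) * (P.specPlus + P.specMinus)

/-- The spectral polynomial `V`; `divX` divides by `X`, and `Δy = (q - 1) x`. -/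
def V : ℂ[X] := C ((2 * (P.q - 1))⁻¹) * (P.specPlus - P.specMinus).divX

theorem W_add_V (hq : P.q ≠ 1) : P.W + C (P.q - 1) * X * P.V = P.specPlus := by
  have h0 : (P.specPlus - P.specMinus).coeff 0 = 0 := by
    simp [specPlus, specMinus, coeff_zero_eq_eval_zero]
  have h1 := X_mul_divX_add (P.specPlus - P.specMinus)
  rw [h0, C_0, add_zero] at h1
  have hq' : P.q - 1 ≠ 0 := sub_ne_zero.mpr hq
  have h2 : C (P.q - 1) * X * P.V = C (2⁻¹ : ℂ) * (P.specPlus - P.specMinus) := by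
    conv_rhs => rw [← h1]
    have h3 : (P.q - 1) * (2 * (P.q - 1))⁻¹ = (2⁻¹ : ℂ) := by field_simp
    rw [V, ← h3, C_mul]
    ring
  have h4 : (C (2⁻¹ : ℂ) : ℂ[X]) * 2 = 1 := by
    rw [show (2 : ℂ[X]) = C 2 from rfl, ← C_mul]; simp
  rw [h2, W]
  linear_combination P.specPlus * h4

theorem W_sub_V (hq : P.q ≠ 1) : P.W - C (P.q - 1) * X * P.V = P.specMinus := by
  have h := P.W_add_V hq
  have h4 : (C (2⁻¹ : ℂ) : ℂ[X]) * 2 = 1 := by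
    rw [show (2 : ℂ[X]) = C 2 from rfl, ← C_mul]; simp
  have h5 : 2 * P.W = P.specPlus + P.specMinus := by
    rw [W]; linear_combination (P.specPlus + P.specMinus) * h4
  linear_combination h5 - h

/-- Both terminals of the `q`-integral are zeros of the weight, and the weight has no pole on the
lattice points that the `q`-integral uses. -/
structure IsAdmissible (α β : ℂ) : Prop where
  num_left : P.weightNum α = 0
  num_right : P.weightNum β = 0
  den_ne_zero : ∀ y ∈ support P.q α β, P.weightDen y ≠ 0

/-- `p` is a sequence of orthonormal polynomials for the weight on the `q`-integral from `α` to
`β`. -/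
structure IsOrthonormal (α β : ℂ) (p : ℕ → ℂ[X]) : Prop where
  natDegree_eq : ∀ n, (p n).natDegree = n
  orthonormal : ∀ m n, jackson P.q α β (fun y => P.weight y * (p m).eval y * (p n).eval y) =
    if m = n then 1 else 0

end Params

/-- The coefficient `a_n` of the recurrence `a_{n+1} p_{n+1} = (x - b_n) p_n - a_n p_{n-1}`: the
ratio of consecutive leading coefficients for `n ≥ 1`, while `a_0` is a free constant. -/
def recCoeff (a₀ : ℂ) (p : ℕ → ℂ[X]) : ℕ → ℂ
  | 0 => a₀
  | n + 1 => (p n).leadingCoeff / (p (n + 1)).leadingCoeff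

/-- The sequence `0, s 0, s 1, …`, that is `n ↦ s (n - 1)` with `s (-1) = 0`. -/
def prev (s : ℕ → ℂ[X]) : ℕ → ℂ[X]
  | 0 => 0
  | n + 1 => s n

namespace Params

variable (P : Params)

/-- The associated function `q_n`, or function of the second kind. -/
def assoc (α β : ℂ) (p : ℕ → ℂ[X]) (n : ℕ) (x : ℂ) : ℂ :=
  jackson P.q α β (fun y => P.weight y * (p n).eval y / (x - y))

/-- The function `q_{n-1}`, with `q_{-1} = 1 / (a_0 γ_0)`, where `γ_0 = p_0`. -/
def assocPrev (α β a₀ : ℂ) (p : ℕ → ℂ[X]) : ℕ → ℂ → ℂ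
  | 0 => fun _ => 1 / (a₀ * (p 0).leadingCoeff)
  | n + 1 => P.assoc α β p n

/-- The matrix variable `Y_n`. -/
def Y (α β a₀ : ℂ) (p : ℕ → ℂ[X]) (n : ℕ) (x : ℂ) : Matrix (Fin 2) (Fin 2) ℂ :=
  !![(p n).eval x, P.assoc α β p n x / P.weight x;
     (prev p n).eval x, P.assocPrev α β a₀ p n x / P.weight x]

/-- The points `x` such that `Y_n` is defined at both `x` and `q x`: none of the two is a zero or a
pole of the weight, or lies on the support, and `x` is not the fixed point `0` of the lattice. -/
def IsRegularPoint (α β x : ℂ) : Prop :=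
  x ≠ 0 ∧ ∀ y ∈ ({x, P.q * x} : Set ℂ),
    y ∉ support P.q α β ∧ P.weightNum y ≠ 0 ∧ P.weightDen y ≠ 0

/-- The polynomials `Wn n`, `Ωn n`, `Θn n` are the spectral coefficients: they are the entries of
the spectral matrix `A_n` in the spectral divided-difference equation `D_x Y_n = A_n M_x Y_n`. -/
structure IsSpectralCoeffs (α β a₀ : ℂ) (p : ℕ → ℂ[X]) (Wn Ωn Θn : ℕ → ℂ[X]) : Prop where
  ne_zero : ∀ n, Wn n ≠ 0
  spectral_eq : ∀ n x, P.IsRegularPoint α β x → (Wn n).eval x ≠ 0 →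
    dividedDiff P.q (P.Y α β a₀ p n) x =
      ((Wn n).eval x)⁻¹ •
        (!![(Ωn n).eval x, -(recCoeff a₀ p n * (Θn n).eval x);
            recCoeff a₀ p n * (prev Θn n).eval x, -(Ωn n).eval x - 2 * P.V.eval x] *
          mean P.q (P.Y α β a₀ p n) x)

end Params

end DeformedBigQJacobi

end

/-! Write S₊ = W + Δy V and S₋ = W - Δy V. The weight satisfies the Pearson equation S₋(x) w(qx) =
S₊(x) w(x). Since w vanishes at both terminals, the q-integral may be rescaled, and the Stieltjes
function f of w satisfies S₋(x) f(qx) - S₊(x) f(x) = D(x) with D a polynomial and D(0) = 0. As q_n =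
p_n f + r_n with r_n a polynomial, the matrix T = S₊ Y_n(qx) Y_n(x)⁻¹ is polynomial. Three facts
describe it: det T = S₊ S₋, from the constant Casoratian of (p_n, q_n); T(0) = b₆t times the
identity; and the orders of p_n and q_n at infinity bound the degrees of its entries and give the
leading coefficients used.

The spectral equation says that T is a Cayley transform, (2W_n - Δy A) T = S₊ (2W_n + Δy A), where A
is the numerator matrix. Its trace -2V and the value of det T force T to have diagonal entries 2W_n
- W ± Δy(Ω_n + V) and off-diagonal entries -Δy a_nΘ_n and Δy a_nΘ_{n-1}
(`transfer_eq_of_spectral_eq`). Conversely, reading the coefficients off T proves existence.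

Hence 2W_n - W is a cubic, Ω_n + V a quadratic and Θ_n linear, with known leading coefficients. In
det T = S₊ S₋ the product Θ_nΘ_{n-1} enters only at x², x³, x⁴. The coefficients of x and x⁵
therefore give two relations free of it (`coeff_of_determinant`), and the remaining freedom is the
pair of values ν_n, μ_n at the zero of Θ_n. At that zero the product drops out, which leaves the
quadratic relation between ν_n and μ_n. -/

namespace DeformedBigQJacobi

open Filter Topology Bornology

/-! ### The infinite q-shifted factorial -/

section qShifted

variable {q : ℂ}

theorem summable_norm_mul_pow (hq : ‖q‖ < 1) (a : ℂ) : Summable fun j : ℕ => ‖-(a * q ^ j)‖ := by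
  simpa [norm_mul, norm_pow] using
    (summable_geometric_of_lt_one (norm_nonneg q) hq).mul_left ‖a‖

theorem multipliable_qShifted (hq : ‖q‖ < 1) (a : ℂ) :
    Multipliable fun j : ℕ => 1 - a * q ^ j := by
  simpa [sub_eq_add_neg] using multipliable_one_add_of_summable (summable_norm_mul_pow hq a)

theorem qShifted_eq_mul (hq : ‖q‖ < 1) (a : ℂ) :
    qShifted q a = (1 - a) * qShifted q (q * a) := by
  have h : ∀ j : ℕ, 1 - a * q ^ (j + 1) = 1 - q * a * q ^ j := fun j => by ring
  rw [qShifted, tprod_eq_zero_mul' (by simpa only [h] using multipliable_qShifted hq (q * a))]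
  simp only [h, pow_zero, mul_one, qShifted]

theorem norm_qShifted_sub_one_le (hq : ‖q‖ < 1) (a : ℂ) :
    ‖qShifted q a - 1‖ ≤ Real.exp (‖a‖ * (1 - ‖q‖)⁻¹) - 1 := by
  have h1 : Tendsto (fun s : Finset ℕ => ‖∏ j ∈ s, (1 - a * q ^ j) - 1‖) atTop
      (𝓝 ‖qShifted q a - 1‖) :=
    ((multipliable_qShifted hq a).hasProd.sub_const 1).norm
  refine le_of_tendsto' h1 fun s => ?_
  have h2 := s.norm_prod_one_add_sub_one_le fun j => -(a * q ^ j)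
  simp only [← sub_eq_add_neg] at h2
  refine h2.trans ?_
  have h3 := (summable_norm_mul_pow hq a).sum_le_tsum s fun _ _ => norm_nonneg _
  simp only [norm_neg, norm_mul, norm_pow, tsum_mul_left,
    tsum_geometric_of_lt_one (norm_nonneg q) hq] at h3
  simpa [norm_mul, norm_pow] using h3

theorem qShifted_zero (q : ℂ) : qShifted q 0 = 1 := by simp [qShifted]

/-- Continuity is needed only at 0, the one accumulation point of the lattices αq^k and βq^k. -/
theorem continuousAt_qShifted_zero (hq : ‖q‖ < 1) : ContinuousAt (qShifted q) 0 := by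
  rw [ContinuousAt, qShifted_zero, tendsto_iff_norm_sub_tendsto_zero]
  refine squeeze_zero (fun _ => norm_nonneg _) (norm_qShifted_sub_one_le hq) ?_
  have : ContinuousAt (fun a : ℂ => Real.exp (‖a‖ * (1 - ‖q‖)⁻¹) - 1) 0 := by fun_prop
  simpa [ContinuousAt] using this

theorem continuousAt_qShifted_mul_zero (hq : ‖q‖ < 1) (c : ℂ) :
    ContinuousAt (fun x => qShifted q (c * x)) 0 := by
  refine ContinuousAt.comp (g := qShifted q) ?_ (by fun_prop)
  simpa using continuousAt_qShifted_zero hq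

end qShifted

/-! ### The Thomae-Jackson integral and Cauchy transforms -/

section jackson

variable {q α β : ℂ}

theorem tendsto_mul_pow_zero (hq : ‖q‖ < 1) (c : ℂ) :
    Tendsto (fun k : ℕ => c * q ^ k) atTop (𝓝 0) := by
  simpa using (tendsto_pow_atTop_nhds_zero_of_norm_lt_one hq).const_mul c

/-- Continuity at 0 bounds h along c q^k, so the geometric series dominates. -/
theorem summable_pow_mul_of_continuousAt (hq : ‖q‖ < 1) {h : ℂ → ℂ} (hh : ContinuousAt h 0)
    (c : ℂ) : Summable fun k : ℕ => q ^ k * h (c * q ^ k) := by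
  have h1 := (hh.tendsto.comp (tendsto_mul_pow_zero hq c)).norm.isBoundedUnder_le
  obtain ⟨M, hM⟩ := h1.bddAbove_range
  refine Summable.of_norm_bounded
    ((summable_geometric_of_lt_one (norm_nonneg q) hq).mul_right M) fun k => ?_
  rw [norm_mul, norm_pow]
  exact mul_le_mul_of_nonneg_left (hM ⟨k, rfl⟩) (by positivity)

theorem left_mem_support (k : ℕ) : α * q ^ k ∈ support q α β := ⟨k, .inl rfl⟩

theorem right_mem_support (k : ℕ) : β * q ^ k ∈ support q α β := ⟨k, .inr rfl⟩

theorem countable_support : (support q α β).Countable := by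
  have : support q α β = Set.range (fun k : ℕ => α * q ^ k) ∪ Set.range fun k : ℕ => β * q ^ k := by
    ext y
    simp only [support, Set.mem_union, Set.mem_range]
    constructor
    · rintro ⟨k, rfl | rfl⟩
      exacts [.inl ⟨k, rfl⟩, .inr ⟨k, rfl⟩]
    · rintro (⟨k, rfl⟩ | ⟨k, rfl⟩)
      exacts [⟨k, .inl rfl⟩, ⟨k, .inr rfl⟩]
  rw [this]
  exact (Set.countable_range _).union (Set.countable_range _)

theorem norm_le_of_mem_support (hq : ‖q‖ < 1) {y : ℂ} (hy : y ∈ support q α β) :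
    ‖y‖ ≤ max ‖α‖ ‖β‖ := by
  have h (k : ℕ) : ‖q‖ ^ k ≤ 1 := pow_le_one₀ (norm_nonneg q) hq.le
  obtain ⟨k, rfl | rfl⟩ := hy
  · rw [norm_mul, norm_pow]
    exact (mul_le_of_le_one_right (norm_nonneg _) (h k)).trans (le_max_left _ _)
  · rw [norm_mul, norm_pow]
    exact (mul_le_of_le_one_right (norm_nonneg _) (h k)).trans (le_max_right _ _)

theorem eventually_notMem_support (hq : ‖q‖ < 1) :
    ∀ᶠ x in cobounded ℂ, x ≠ 0 ∧ x ∉ support q α β := by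
  filter_upwards [(tendsto_norm_cobounded_atTop (E := ℂ)).eventually_gt_atTop (max ‖α‖ ‖β‖)]
    with x hx
  refine ⟨?_, fun h => (norm_le_of_mem_support hq h).not_gt hx⟩
  rintro rfl
  have := (norm_nonneg α).trans (le_max_left ‖α‖ ‖β‖)
  simp at hx
  linarith [hx.1, norm_nonneg α, norm_nonneg β]

theorem jackson_congr {f g : ℂ → ℂ} (h : ∀ y ∈ support q α β, f y = g y) :
    jackson q α β f = jackson q α β g := by
  simp only [jackson, h _ (left_mem_support _), h _ (right_mem_support _)]

theorem jackson_add (hq : ‖q‖ < 1) {f g : ℂ → ℂ} (hf : ContinuousAt f 0) (hg : ContinuousAt g 0) :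
    jackson q α β (fun y => f y + g y) = jackson q α β f + jackson q α β g := by
  have h (c : ℂ) : ∑' k : ℕ, q ^ k * (f (c * q ^ k) + g (c * q ^ k)) =
      ∑' k : ℕ, q ^ k * f (c * q ^ k) + ∑' k : ℕ, q ^ k * g (c * q ^ k) := by
    rw [← (summable_pow_mul_of_continuousAt hq hf c).tsum_add
      (summable_pow_mul_of_continuousAt hq hg c)]
    simp only [mul_add]
  simp only [jackson, h]
  ring

theorem jackson_const_mul (c : ℂ) (f : ℂ → ℂ) :
    jackson q α β (fun y => c * f y) = c * jackson q α β f := by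
  simp only [jackson, mul_left_comm _ c, tsum_mul_left]
  ring

theorem jackson_sub (hq : ‖q‖ < 1) {f g : ℂ → ℂ} (hf : ContinuousAt f 0) (hg : ContinuousAt g 0) :
    jackson q α β (fun y => f y - g y) = jackson q α β f - jackson q α β g := by
  have h := jackson_add (α := α) (β := β) hq hf (hg.const_mul (-1))
  rw [jackson_const_mul] at h
  simpa [sub_eq_add_neg] using h

/-- Scaling invariance of the `q`-integral of a function vanishing at both terminals. -/
theorem jackson_eq_mul_jackson_comp (hq : ‖q‖ < 1) {h : ℂ → ℂ} (hh : ContinuousAt h 0)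
    (hα : h α = 0) (hβ : h β = 0) :
    jackson q α β h = q * jackson q α β fun y => h (q * y) := by
  have key (c : ℂ) (hc : h c = 0) : ∑' k : ℕ, q ^ k * h (c * q ^ k) =
      q * ∑' k : ℕ, q ^ k * h (q * (c * q ^ k)) := by
    rw [(summable_pow_mul_of_continuousAt hq hh c).tsum_eq_zero_add, ← tsum_mul_left]
    simp only [pow_zero, mul_one, hc, mul_zero, zero_add]
    congr! 2 with k
    rw [pow_succ', show c * (q * q ^ k) = q * (c * q ^ k) by ring]
    ring
  simp only [jackson, key α hα, key β hβ]
  ring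

/-- The Cauchy transform of `m` tends to `0` at infinity. -/
theorem tendsto_jackson_div_sub (hq : ‖q‖ < 1) {m : ℂ → ℂ} (hm : ContinuousAt m 0) :
    Tendsto (fun x => jackson q α β fun y => m y / (x - y)) (cobounded ℂ) (𝓝 0) := by
  have key (c : ℂ) : Tendsto (fun x => ∑' k : ℕ, q ^ k * (m (c * q ^ k) / (x - c * q ^ k)))
      (cobounded ℂ) (𝓝 0) := by
    rw [← tsum_zero (α := ℂ) (β := ℕ)]
    refine tendsto_tsum_of_dominated_convergence
      (summable_pow_mul_of_continuousAt hq hm c).norm (fun k => ?_) ?_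
    · have h1 : Tendsto (fun x : ℂ => x - c * q ^ k) (cobounded ℂ) (cobounded ℂ) := by
        simp [sub_eq_add_neg]
      have h2 := ((tendsto_inv₀_cobounded.comp h1).const_mul (q ^ k * m (c * q ^ k)))
      simpa [div_eq_mul_inv, mul_assoc, Function.comp_def] using h2
    · filter_upwards [(tendsto_norm_cobounded_atTop (E := ℂ)).eventually_ge_atTop (‖c‖ + 1)]
        with x hx k
      have h1 : ‖c * q ^ k‖ ≤ ‖c‖ := by
        rw [norm_mul, norm_pow]
        exact mul_le_of_le_one_right (norm_nonneg _) (pow_le_one₀ (norm_nonneg q) hq.le)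
      have h2 : 1 ≤ ‖x - c * q ^ k‖ := by
        linarith [norm_sub_norm_le x (c * q ^ k)]
      rw [← mul_div_assoc, norm_div]
      exact div_le_self (norm_nonneg _) h2
  simpa [jackson] using ((key β).const_mul ((1 - q) * β)).sub ((key α).const_mul ((1 - q) * α))

theorem continuousAt_div_sub {m : ℂ → ℂ} (hm : ContinuousAt m 0) {x : ℂ} (hx : x ≠ 0) :
    ContinuousAt (fun y => m y / (x - y)) 0 :=
  hm.div (by fun_prop) (by simpa using hx)

/-- Multiplication of the density by the variable. -/
theorem jackson_mul_div_sub (hq : ‖q‖ < 1) {m : ℂ → ℂ} (hm : ContinuousAt m 0) {x : ℂ}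
    (hx : x ≠ 0 ∧ x ∉ support q α β) :
    jackson q α β (fun y => m y * y / (x - y)) =
      x * jackson q α β (fun y => m y / (x - y)) - jackson q α β m := by
  rw [← jackson_const_mul, ← jackson_sub hq ((continuousAt_div_sub hm hx.1).const_mul x) hm]
  refine jackson_congr fun y hy => ?_
  have : x - y ≠ 0 := sub_ne_zero.mpr fun h => hx.2 (h ▸ hy)
  field_simp
  ring

/-- Multiplying the density by a polynomial `g` multiplies its Cauchy transform by `g`, up to a
polynomial. -/
theorem exists_polynomial_jackson (hq : ‖q‖ < 1) {m : ℂ → ℂ} (hm : ContinuousAt m 0) (g : ℂ[X]) :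
    ∃ r : ℂ[X], r.eval 0 = -jackson q α β (fun y => m y * g.divX.eval y) ∧
      ∀ x, x ≠ 0 ∧ x ∉ support q α β →
        jackson q α β (fun y => m y * g.eval y / (x - y)) =
          g.eval x * jackson q α β (fun y => m y / (x - y)) + r.eval x := by
  -- The recursion g = y · `g.divX` + g(0) lowers the degree; each factor y costs a constant, by
  -- `jackson_mul_div_sub`. The value r(0) serves later to show D(0) = 0.
  induction hN : g.natDegree using Nat.strong_induction_on generalizing g with
  | _ N ih =>
  have hmg (g : ℂ[X]) : ContinuousAt (fun y => m y * g.eval y) 0 := hm.mul (by fun_prop)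
  obtain ⟨r, hr⟩ : ∃ r : ℂ[X], ∀ x, x ≠ 0 ∧ x ∉ support q α β →
      jackson q α β (fun y => m y * g.divX.eval y / (x - y)) =
        g.divX.eval x * jackson q α β (fun y => m y / (x - y)) + r.eval x := by
    rcases Nat.eq_zero_or_pos g.natDegree with h0 | h0
    · refine ⟨0, fun x _ => ?_⟩
      rw [divX_eq_zero_iff.mpr (eq_C_of_natDegree_eq_zero h0)]
      simp [jackson]
    · obtain ⟨r, -, hr⟩ := ih g.divX.natDegree
        (by rw [natDegree_divX_eq_natDegree_tsub_one]; omega) g.divX rfl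
      exact ⟨r, hr⟩
  refine ⟨X * r - C (jackson q α β (fun y => m y * g.divX.eval y)), by simp, fun x hx => ?_⟩
  have hg (y : ℂ) : g.eval y = g.divX.eval y * y + g.coeff 0 := by
    conv_lhs => rw [← divX_mul_X_add g]
    simp
  have h1 : jackson q α β (fun y => m y * g.eval y / (x - y)) =
      jackson q α β (fun y => m y * g.divX.eval y * y / (x - y)) +
        g.coeff 0 * jackson q α β (fun y => m y / (x - y)) := by
    have h2 : ContinuousAt (fun y => m y * g.divX.eval y * y) 0 := (hmg g.divX).mul continuousAt_id
    rw [← jackson_const_mul, ← jackson_add hq (continuousAt_div_sub h2 hx.1)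
      ((continuousAt_div_sub hm hx.1).const_mul _)]
    refine jackson_congr fun y _ => ?_
    rw [hg y]
    ring
  rw [h1, jackson_mul_div_sub hq (hmg g.divX) hx, hr x hx, hg x]
  simp only [eval_sub, eval_mul, eval_X, eval_C]
  ring

end jackson

/-! ### Pearson equations of the weight and of its Stieltjes function -/

namespace Params

variable {P : Params} {α β : ℂ}

theorem specPlus_eval (x : ℂ) :
    P.specPlus.eval x = P.b₆ * (1 - P.b₁ * x) * (1 - P.b₄ * x) * (P.t - P.b₆ * x) := by
  simp [specPlus]

theorem specMinus_eval (x : ℂ) :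
    P.specMinus.eval x = (1 - P.b₂ * x) * (1 - P.b₃ * x) * (P.b₆ * P.t - x) := by
  simp [specMinus]

/-- Each q-shifted factorial sheds its first factor. Being free of division, this form also holds at
zeros and poles of the weight. -/
theorem weightNum_rec (hq1 : ‖P.q‖ < 1) (hb₆ : P.b₆ ≠ 0) (ht : P.t ≠ 0) (x : ℂ) :
    P.b₆ * P.t * P.weightNum x = P.specMinus.eval x * P.weightNum (P.q * x) := by
  have h (c : ℂ) : P.q * (c * x) = c * (P.q * x) := by ring
  have h' : P.q * (P.b₆⁻¹ * x * P.t⁻¹) = P.b₆⁻¹ * (P.q * x) * P.t⁻¹ := by ring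
  rw [weightNum, qShifted_eq_mul hq1 (P.b₂ * x), qShifted_eq_mul hq1 (P.b₃ * x),
    qShifted_eq_mul hq1 (P.b₆⁻¹ * x * P.t⁻¹), h, h, h', specMinus_eval, weightNum]
  field_simp

theorem weightDen_rec (hq1 : ‖P.q‖ < 1) (ht : P.t ≠ 0) (x : ℂ) :
    P.b₆ * P.t * P.weightDen x = P.specPlus.eval x * P.weightDen (P.q * x) := by
  have h (c : ℂ) : P.q * (c * x) = c * (P.q * x) := by ring
  have h' : P.q * (P.b₆ * x * P.t⁻¹) = P.b₆ * (P.q * x) * P.t⁻¹ := by ring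
  rw [weightDen, qShifted_eq_mul hq1 (P.b₁ * x), qShifted_eq_mul hq1 (P.b₄ * x),
    qShifted_eq_mul hq1 (P.b₆ * x * P.t⁻¹), h, h, h', specPlus_eval, weightDen]
  field_simp

theorem specPlus_ne_zero_of_weightDen (hq1 : ‖P.q‖ < 1) (hb₆ : P.b₆ ≠ 0) (ht : P.t ≠ 0) {x : ℂ}
    (hx : P.weightDen x ≠ 0) : P.specPlus.eval x ≠ 0 ∧ P.weightDen (P.q * x) ≠ 0 := by
  have h : P.b₆ * P.t * P.weightDen x ≠ 0 := mul_ne_zero (mul_ne_zero hb₆ ht) hx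
  rw [weightDen_rec hq1 ht] at h
  exact ⟨left_ne_zero_of_mul h, right_ne_zero_of_mul h⟩

/-- The Pearson equation of the weight. -/
theorem specMinus_mul_weight (hq1 : ‖P.q‖ < 1) (hb₆ : P.b₆ ≠ 0) (ht : P.t ≠ 0) {x : ℂ}
    (hx : P.weightDen x ≠ 0) :
    P.specMinus.eval x * P.weight (P.q * x) = P.specPlus.eval x * P.weight x := by
  obtain ⟨-, h2⟩ := specPlus_ne_zero_of_weightDen hq1 hb₆ ht hx
  have hb : P.b₆ * P.t ≠ 0 := mul_ne_zero hb₆ ht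
  rw [weight, weight, ← mul_div_assoc, ← mul_div_assoc, div_eq_div_iff h2 hx,
    ← weightNum_rec hq1 hb₆ ht]
  linear_combination P.weightNum x * weightDen_rec hq1 ht x

theorem weightNum_zero (P : Params) : P.weightNum 0 = 1 := by simp [weightNum, qShifted_zero]

theorem weightDen_zero (P : Params) : P.weightDen 0 = 1 := by simp [weightDen, qShifted_zero]

theorem weight_zero (P : Params) : P.weight 0 = 1 := by
  simp [weight, weightNum_zero, weightDen_zero]

theorem continuousAt_weightNum (hq1 : ‖P.q‖ < 1) : ContinuousAt P.weightNum 0 := by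
  have h : (fun x => qShifted P.q (P.b₆⁻¹ * x * P.t⁻¹)) =
      fun x => qShifted P.q (P.b₆⁻¹ * P.t⁻¹ * x) := by
    funext x; congr 1; ring
  exact ((continuousAt_qShifted_mul_zero hq1 _).mul (continuousAt_qShifted_mul_zero hq1 _)).mul
    (h ▸ continuousAt_qShifted_mul_zero hq1 _)

theorem continuousAt_weightDen (hq1 : ‖P.q‖ < 1) : ContinuousAt P.weightDen 0 := by
  have h : (fun x => qShifted P.q (P.b₆ * x * P.t⁻¹)) =
      fun x => qShifted P.q (P.b₆ * P.t⁻¹ * x) := by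
    funext x; congr 1; ring
  exact ((continuousAt_qShifted_mul_zero hq1 _).mul (continuousAt_qShifted_mul_zero hq1 _)).mul
    (h ▸ continuousAt_qShifted_mul_zero hq1 _)

theorem continuousAt_weight (hq1 : ‖P.q‖ < 1) : ContinuousAt P.weight 0 :=
  (continuousAt_weightNum hq1).div (continuousAt_weightDen hq1) (by simp [weightDen_zero])

theorem continuousAt_comp_mul {f : ℂ → ℂ} (hf : ContinuousAt f 0) (c : ℂ) :
    ContinuousAt (fun x => f (c * x)) 0 :=
  ContinuousAt.comp (g := f) (by simpa using hf) (by fun_prop)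

theorem IsAdmissible.ne_zero (h : P.IsAdmissible α β) : α ≠ 0 ∧ β ≠ 0 := by
  constructor
  · rintro rfl; simpa [weightNum_zero] using h.num_left
  · rintro rfl; simpa [weightNum_zero] using h.num_right

/-- Near 0 the numerator and denominator are close to 1, at x and at qx. The other conditions
exclude countably many points, and a countable set has dense complement. -/
theorem infinite_setOf_isRegularPoint (hq0 : P.q ≠ 0) (hq1 : ‖P.q‖ < 1) :
    {x | P.IsRegularPoint α β x}.Infinite := by
  intro hfin
  have h1 : ∀ᶠ x in 𝓝 (0 : ℂ), (P.weightNum x ≠ 0 ∧ P.weightDen x ≠ 0) ∧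
      (P.weightNum (P.q * x) ≠ 0 ∧ P.weightDen (P.q * x) ≠ 0) := by
    have hn := continuousAt_weightNum hq1
    have hd := continuousAt_weightDen hq1
    refine ((hn.eventually_ne ?_).and (hd.eventually_ne ?_)).and
      (((continuousAt_comp_mul hn P.q).eventually_ne ?_).and
        ((continuousAt_comp_mul hd P.q).eventually_ne ?_)) <;>
    simp [weightNum_zero, weightDen_zero]
  have hc : ({x | P.IsRegularPoint α β x} ∪ {0} ∪ support P.q α β ∪
      (fun x => P.q * x) ⁻¹' support P.q α β).Countable :=
    ((hfin.countable.union (Set.countable_singleton 0)).union countable_support).union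
      (countable_support.preimage (mul_right_injective₀ hq0))
  obtain ⟨x, hx, hx'⟩ := mem_closure_iff_nhds.mp ((hc.dense_compl ℂ) 0) _ h1
  simp only [Set.mem_compl_iff, Set.mem_union, not_or] at hx'
  obtain ⟨⟨⟨hr, h0⟩, hs⟩, hs'⟩ := hx'
  refine hr ⟨h0, ?_⟩
  rintro y (rfl | rfl)
  · exact ⟨hs, hx.1⟩
  · exact ⟨hs', hx.2⟩

/-- The polynomials `W + Δy V` and `W - Δy V` are different: otherwise the weight would be
constant along the lattice, although it vanishes at its terminal. -/
theorem specPlus_ne_specMinus (hq1 : ‖P.q‖ < 1) (hb₆ : P.b₆ ≠ 0) (ht : P.t ≠ 0)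
    (h : P.IsAdmissible α β) : P.specPlus ≠ P.specMinus := by
  intro he
  -- If S₊ = S₋, the zero of the numerator at α propagates to every αq^k, because S₊ does not vanish
  -- there; the limit at 0 would be 0 instead of 1.
  have h1 (k : ℕ) : P.weightNum (α * P.q ^ k) = 0 := by
    induction k with
    | zero => simpa using h.num_left
    | succ k ih =>
      have h2 := weightNum_rec hq1 hb₆ ht (α * P.q ^ k)
      have h3 := (specPlus_ne_zero_of_weightDen hq1 hb₆ ht
        (h.den_ne_zero _ (left_mem_support k))).1
      rw [ih, mul_zero, ← he, zero_eq_mul, or_iff_right h3] at h2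
      rwa [pow_succ', ← mul_assoc, mul_comm α, mul_assoc]
  have h4 := (continuousAt_weightNum hq1).tendsto.comp (tendsto_mul_pow_zero hq1 α)
  simp only [Function.comp_def, h1, weightNum_zero] at h4
  exact zero_ne_one (tendsto_nhds_unique tendsto_const_nhds h4)

theorem q_ne_one (hq1 : ‖P.q‖ < 1) : P.q ≠ 1 := by
  intro h
  rw [h] at hq1
  simp at hq1

theorem V_ne_zero (hq1 : ‖P.q‖ < 1) (hb₆ : P.b₆ ≠ 0) (ht : P.t ≠ 0)
    (h : P.IsAdmissible α β) : P.V ≠ 0 := by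
  intro hV
  have h1 := P.W_add_V (q_ne_one hq1)
  have h2 := P.W_sub_V (q_ne_one hq1)
  rw [hV] at h1 h2
  exact specPlus_ne_specMinus hq1 hb₆ ht h (by rw [← h1, ← h2]; simp)

theorem continuousAt_mul_eval {m : ℂ → ℂ} (hm : ContinuousAt m 0) (g : ℂ[X]) :
    ContinuousAt (fun y => m y * g.eval y) 0 :=
  hm.mul (by fun_prop)

theorem continuousAt_weight_mul_eval (hq1 : ‖P.q‖ < 1) (g : ℂ[X]) :
    ContinuousAt (fun y => P.weight y * g.eval y) 0 :=
  continuousAt_mul_eval (continuousAt_weight hq1) g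

variable (P α β) in
/-- The Stieltjes function of the weight. -/
noncomputable def stieltjes (x : ℂ) : ℂ := jackson P.q α β fun y => P.weight y / (x - y)

/-- Substituting y → qy loses no boundary term, since w vanishes at the terminals; the factor q
cancels against qx - qy. -/
theorem stieltjes_mul (hq0 : P.q ≠ 0) (hq1 : ‖P.q‖ < 1) (h : P.IsAdmissible α β) {x : ℂ}
    (hx : x ≠ 0) :
    P.stieltjes α β (P.q * x) = jackson P.q α β fun y => P.weight (P.q * y) / (x - y) := by
  rw [stieltjes, jackson_eq_mul_jackson_comp hq1
    (continuousAt_div_sub (continuousAt_weight hq1) (mul_ne_zero hq0 hx)), ← jackson_const_mul]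
  · refine jackson_congr fun y _ => ?_
    rw [← mul_sub, ← div_div, ← mul_div_assoc, mul_div_cancel₀ _ hq0]
  · simp [weight, h.num_left]
  · simp [weight, h.num_right]

/-- Telescoping of the `q`-integral of a `q`-difference. -/
theorem jackson_eq_zero_of_mul_eq (hq1 : ‖P.q‖ < 1) (h : P.IsAdmissible α β)
    {f : ℂ → ℂ} (hf : ContinuousAt f 0) (c : ℂ)
    (hfc : ∀ y ∈ support P.q α β, y * f y = c * (P.weight y - P.weight (P.q * y))) :
    jackson P.q α β f = 0 := by
  have key (a : ℂ) (ha : a ≠ 0) (ha0 : P.weight a = 0)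
      (hfa : ∀ k : ℕ, a * P.q ^ k * f (a * P.q ^ k) =
        c * (P.weight (a * P.q ^ k) - P.weight (P.q * (a * P.q ^ k)))) :
      a * ∑' k : ℕ, P.q ^ k * f (a * P.q ^ k) = -c := by
    rw [← tsum_mul_left]
    have hs : Summable fun k : ℕ => a * (P.q ^ k * f (a * P.q ^ k)) :=
      (summable_pow_mul_of_continuousAt hq1 hf a).mul_left a
    refine tendsto_nhds_unique hs.hasSum.tendsto_sum_nat ?_
    -- The sum telescopes, and its limit -c · w(0) = -c does not depend on the terminal, so the two
    -- terminals cancel.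
    have h1 (N : ℕ) : ∑ k ∈ Finset.range N, a * (P.q ^ k * f (a * P.q ^ k)) =
        -(c * P.weight (a * P.q ^ N)) := by
      induction N with
      | zero => simp [ha0]
      | succ N ih =>
        rw [Finset.sum_range_succ, ih, ← mul_assoc, hfa,
          show P.q * (a * P.q ^ N) = a * P.q ^ (N + 1) by ring]
        ring
    simp only [h1]
    have h2 := (continuousAt_weight hq1).tendsto.comp (tendsto_mul_pow_zero hq1 a)
    rw [weight_zero] at h2
    simpa using (h2.const_mul c).neg
  have hα := key α h.ne_zero.1 (by simp [weight, h.num_left])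
    fun k => hfc _ (left_mem_support k)
  have hβ := key β h.ne_zero.2 (by simp [weight, h.num_right])
    fun k => hfc _ (right_mem_support k)
  rw [jackson, mul_assoc, mul_assoc, hα, hβ, sub_self]

/-- The Stieltjes function satisfies an inhomogeneous Pearson equation with polynomial right-hand
side. -/
theorem exists_stieltjes_pearson (hq0 : P.q ≠ 0) (hq1 : ‖P.q‖ < 1) (hb₆ : P.b₆ ≠ 0)
    (ht : P.t ≠ 0) (h : P.IsAdmissible α β) :
    ∃ D : ℂ[X], D.eval 0 = 0 ∧ ∀ x, x ≠ 0 ∧ x ∉ support P.q α β →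
      P.specMinus.eval x * P.stieltjes α β (P.q * x) -
        P.specPlus.eval x * P.stieltjes α β x = D.eval x := by
  have hw := continuousAt_weight (P := P) hq1
  have hwq := continuousAt_comp_mul hw P.q
  obtain ⟨r, hr0, hr⟩ := exists_polynomial_jackson (α := α) (β := β) hq1 hw P.specPlus
  obtain ⟨s, hs0, hs⟩ := exists_polynomial_jackson (α := α) (β := β) hq1 hwq P.specMinus
  refine ⟨r - s, ?_, fun x hx => ?_⟩
  -- D(0) is the integral of w(qy) `specMinus.divX` - w(y) `specPlus.divX`. As S₊(0) = S₋(0) = b₆t,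
  -- the Pearson equation turns y times this integrand into b₆t (w(y) - w(qy)), which telescopes.
  · rw [eval_sub, hr0, hs0, sub_eq_add_neg, neg_neg, add_comm, ← sub_eq_add_neg,
      ← jackson_sub hq1 (continuousAt_mul_eval hwq _) (continuousAt_mul_eval hw _)]
    refine jackson_eq_zero_of_mul_eq hq1 h (.sub (continuousAt_mul_eval hwq _)
      (continuousAt_mul_eval hw _)) (P.b₆ * P.t) fun y hy => ?_
    have h1 := specMinus_mul_weight hq1 hb₆ ht (h.den_ne_zero y hy)
    have h2 : P.specPlus.eval y = P.specPlus.divX.eval y * y + P.b₆ * P.t := by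
      conv_lhs => rw [← divX_mul_X_add P.specPlus]
      simp [coeff_zero_eq_eval_zero, specPlus_eval]
    have h3 : P.specMinus.eval y = P.specMinus.divX.eval y * y + P.b₆ * P.t := by
      conv_lhs => rw [← divX_mul_X_add P.specMinus]
      simp [coeff_zero_eq_eval_zero, specMinus_eval]
    rw [h2, h3] at h1
    linear_combination h1
  · have h1 := hr x hx
    have h2 := hs x hx
    rw [← stieltjes_mul hq0 hq1 h hx.1] at h2
    have h3 : jackson P.q α β (fun y => P.weight (P.q * y) * P.specMinus.eval y / (x - y)) =
        jackson P.q α β (fun y => P.weight y * P.specPlus.eval y / (x - y)) :=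
      jackson_congr fun y hy => by
        rw [mul_comm, specMinus_mul_weight hq1 hb₆ ht (h.den_ne_zero y hy), mul_comm]
    rw [h3, h1, ← stieltjes] at h2
    rw [eval_sub]
    linear_combination -h2

/-! ### The orthonormal polynomials and their associated functions -/

section orthonormal

variable {p : ℕ → ℂ[X]}

theorem IsOrthonormal.ne_zero (hp : P.IsOrthonormal α β p) (n : ℕ) : p n ≠ 0 := by
  intro h
  have := hp.orthonormal n n
  simp [h, jackson] at this

/-- Subtracting a multiple of p_m removes the top coefficient of g, and p_m is orthogonal to p_n for
m < n. -/
theorem IsOrthonormal.jackson_mul_eq_zero (hq1 : ‖P.q‖ < 1) (hp : P.IsOrthonormal α β p) {n : ℕ} :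
    ∀ m ≤ n, ∀ g : ℂ[X], g.degree < m →
      jackson P.q α β (fun y => P.weight y * (p n).eval y * g.eval y) = 0 := by
  intro m
  induction m with
  | zero =>
    intro _ g hg
    have : g = 0 := by simpa [degree_eq_bot] using Nat.WithBot.lt_zero_iff.mp hg
    simp [this, jackson]
  | succ m ih =>
    intro hm g hg
    have hpm : (p m).degree = m := by
      rw [degree_eq_natDegree (hp.ne_zero m), hp.natDegree_eq]
    have hl : (p m).coeff m ≠ 0 := by
      have := leadingCoeff_ne_zero.mpr (hp.ne_zero m)
      rwa [leadingCoeff, hp.natDegree_eq] at this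
    set c := g.coeff m / (p m).coeff m with hc
    have hg' : (g - C c * p m).degree < m := by
      rw [degree_lt_iff_coeff_zero]
      intro k hk
      rcases hk.eq_or_lt with rfl | hk
      · simp [hc, hl]
      · have h1 : g.coeff k = 0 := (degree_lt_iff_coeff_zero _ _).mp hg k hk
        have h2 : (p m).coeff k = 0 :=
          coeff_eq_zero_of_degree_lt (by rw [hpm]; exact_mod_cast hk)
        simp [h1, h2]
    have h1 := ih (by omega) _ hg'
    have h2 := hp.orthonormal n m
    rw [if_neg (by omega)] at h2
    have h3 : ∀ y, P.weight y * (p n).eval y * g.eval y =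
        P.weight y * (p n).eval y * (g - C c * p m).eval y +
          c * (P.weight y * (p n).eval y * (p m).eval y) := fun y => by simp; ring
    have hw := continuousAt_weight_mul_eval (P := P) hq1 (p n)
    simp only [h3]
    rw [jackson_add hq1 (continuousAt_mul_eval hw _) ((continuousAt_mul_eval hw _).const_mul c),
      jackson_const_mul, h1, h2, mul_zero, add_zero]

theorem IsOrthonormal.jackson_mul_pow (hq1 : ‖P.q‖ < 1) (hp : P.IsOrthonormal α β p) (n : ℕ) :
    jackson P.q α β (fun y => P.weight y * (p n).eval y * y ^ n) = ((p n).leadingCoeff)⁻¹ := by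
  have hl := leadingCoeff_ne_zero.mpr (hp.ne_zero n)
  have hd : (p n).degree = n := by
    rw [degree_eq_natDegree (hp.ne_zero n), hp.natDegree_eq]
  set c := ((p n).leadingCoeff)⁻¹ with hc
  have hg : (X ^ n - C c * p n).degree < (n : WithBot ℕ) := by
    rw [degree_lt_iff_coeff_zero]
    intro k hk
    rcases hk.eq_or_lt with rfl | hk
    · have : (p n).coeff n = (p n).leadingCoeff := by rw [leadingCoeff, hp.natDegree_eq]
      simp [hc, this, hl]
    · have h2 : (p n).coeff k = 0 :=
        coeff_eq_zero_of_degree_lt (by rw [hd]; exact_mod_cast hk)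
      simp [h2, coeff_X_pow, hk.ne']
  have h1 := hp.jackson_mul_eq_zero hq1 n le_rfl _ hg
  have h2 := hp.orthonormal n n
  rw [if_pos rfl] at h2
  have h3 : ∀ y, P.weight y * (p n).eval y * y ^ n =
      P.weight y * (p n).eval y * (X ^ n - C c * p n).eval y +
        c * (P.weight y * (p n).eval y * (p n).eval y) := fun y => by simp; ring
  have hw := continuousAt_weight_mul_eval (P := P) hq1 (p n)
  simp only [h3]
  rw [jackson_add hq1 (continuousAt_mul_eval hw _) ((continuousAt_mul_eval hw _).const_mul c),
    jackson_const_mul, h1, h2, mul_one, zero_add]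

/-- Moving one factor x under the integral as y costs the moment of w p_n y^j, which vanishes for j
< n. -/
theorem IsOrthonormal.pow_mul_assoc (hq1 : ‖P.q‖ < 1) (hp : P.IsOrthonormal α β p) {n : ℕ}
    {x : ℂ} (hx : x ≠ 0 ∧ x ∉ support P.q α β) : ∀ j ≤ n, x ^ j * P.assoc α β p n x =
      jackson P.q α β fun y => P.weight y * (p n).eval y * y ^ j / (x - y) := by
  have hc := continuousAt_weight_mul_eval (P := P) hq1 (p n)
  intro j
  induction j with
  | zero => intro _; simp [assoc]
  | succ j ih =>
    intro hj
    have h1 := hp.jackson_mul_eq_zero hq1 (j + 1) hj (X ^ j)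
      (by rw [degree_X_pow]; exact_mod_cast j.lt_succ_self)
    have h2 := jackson_mul_div_sub hq1 (m := fun y => P.weight y * (p n).eval y * y ^ j)
      (hc.mul (by fun_prop)) hx
    simp only [eval_pow, eval_X] at h1
    rw [pow_succ', mul_assoc, ih (by omega), ← sub_zero (x * _), ← h1, ← h2]
    exact jackson_congr fun y _ => by ring

/-- The behaviour of the associated functions at infinity. -/
theorem IsOrthonormal.tendsto_pow_mul_assoc (hq1 : ‖P.q‖ < 1) (hp : P.IsOrthonormal α β p)
    (n : ℕ) : Tendsto (fun x => x ^ (n + 1) * P.assoc α β p n x) (cobounded ℂ)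
      (𝓝 ((p n).leadingCoeff)⁻¹) := by
  have hc := continuousAt_weight_mul_eval (P := P) hq1 (p n)
  have hm : ContinuousAt (fun y => P.weight y * (p n).eval y * y ^ n) 0 := hc.mul (by fun_prop)
  have hm' : ContinuousAt (fun y => P.weight y * (p n).eval y * y ^ n * y) 0 :=
    hm.mul continuousAt_id
  have h1 := (tendsto_jackson_div_sub (α := α) (β := β) hq1 hm').add_const
    ((p n).leadingCoeff)⁻¹
  rw [zero_add] at h1
  refine h1.congr' ?_
  filter_upwards [eventually_notMem_support (α := α) (β := β) hq1] with x hx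
  have h2 := jackson_mul_div_sub hq1 hm hx
  rw [hp.jackson_mul_pow hq1 n] at h2
  rw [pow_succ', mul_assoc, hp.pow_mul_assoc hq1 hx n le_rfl]
  linear_combination h2

end orthonormal

end Params

/-! ### Growth at infinity -/

/-- The function `x ^ s * f x` tends to `c` at infinity. -/
def ScaledLimit (f : ℂ → ℂ) (s : ℤ) (c : ℂ) : Prop :=
  Tendsto (fun x => x ^ s * f x) (cobounded ℂ) (𝓝 c)

namespace ScaledLimit

variable {f g : ℂ → ℂ} {s t : ℤ} {c d : ℂ}

theorem mul (hf : ScaledLimit f s c) (hg : ScaledLimit g t d) :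
    ScaledLimit (fun x => f x * g x) (s + t) (c * d) := by
  refine (Tendsto.mul hf hg).congr' ?_
  filter_upwards [eventually_ne_cobounded (0 : ℂ)] with x hx
  rw [zpow_add₀ hx]
  ring

theorem sub (hf : ScaledLimit f s c) (hg : ScaledLimit g s d) :
    ScaledLimit (fun x => f x - g x) s (c - d) :=
  (Tendsto.sub hf hg).congr fun x => by ring

theorem const_mul (hf : ScaledLimit f s c) (a : ℂ) : ScaledLimit (fun x => a * f x) s (a * c) :=
  (Tendsto.const_mul a hf).congr fun x => by ring

theorem of_lt (hf : ScaledLimit f s c) (h : t < s) : ScaledLimit f t 0 := by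
  have h1 : Tendsto (fun x : ℂ => x ^ (t - s)) (cobounded ℂ) (𝓝 0) := by
    obtain ⟨k, hk⟩ : ∃ k : ℕ, s - t = k + 1 := ⟨(s - t - 1).toNat, by omega⟩
    have h2 := (tendsto_inv₀_cobounded (α := ℂ)).pow (k + 1)
    simp only [ne_eq, Nat.add_eq_zero_iff, one_ne_zero, and_false, not_false_eq_true,
      zero_pow] at h2
    refine h2.congr fun x => ?_
    rw [show t - s = -((k + 1 : ℕ) : ℤ) by push_cast; omega, zpow_neg, zpow_natCast, inv_pow]
  have h2 := Tendsto.mul h1 hf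
  rw [zero_mul] at h2
  refine h2.congr' ?_
  filter_upwards [eventually_ne_cobounded (0 : ℂ)] with x hx
  rw [← mul_assoc, ← zpow_add₀ hx, sub_add_cancel]

theorem comp_mul (hf : ScaledLimit f s c) {q : ℂ} (hq : q ≠ 0) :
    ScaledLimit (fun x => f (q * x)) s (q ^ (-s) * c) := by
  refine ((Tendsto.comp hf (tendsto_mul_left_cobounded hq)).const_mul (q ^ (-s))).congr fun x => ?_
  simp only [Function.comp_def, mul_zpow, zpow_neg]
  have := zpow_ne_zero s hq
  field_simp

theorem congr' (hf : ScaledLimit f s c) (h : f =ᶠ[cobounded ℂ] g) : ScaledLimit g s c :=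
  Tendsto.congr' (h.mono fun x hx => by simp only [hx]) hf

theorem cast (hf : ScaledLimit f s c) (hs : s = t) (hc : c = d) : ScaledLimit f t d :=
  hs ▸ hc ▸ hf

theorem unique (hf : ScaledLimit f s c) (hg : ScaledLimit f s d) : c = d :=
  tendsto_nhds_unique hf hg

theorem polynomial_eval (Q : ℂ[X]) {k : ℕ} (hk : Q.natDegree ≤ k) :
    ScaledLimit (fun x => Q.eval x) (-k) (Q.coeff k) := by
  have h1 : (Q - C (Q.coeff k) * X ^ k).degree < (X ^ k : ℂ[X]).degree := by
    rw [degree_X_pow, degree_lt_iff_coeff_zero]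
    intro m hm
    rcases hm.eq_or_lt with rfl | hm
    · simp
    · simp [coeff_eq_zero_of_natDegree_lt (hk.trans_lt hm), coeff_X_pow, hm.ne']
  have h2 := ((isLittleO_cobounded_of_degree_lt h1).tendsto_div_nhds_zero).add_const (Q.coeff k)
  rw [zero_add] at h2
  refine h2.congr' ?_
  filter_upwards [eventually_ne_cobounded (0 : ℂ)] with x hx
  simp only [eval_sub, eval_mul, eval_C, eval_pow, eval_X, zpow_neg, zpow_natCast]
  field_simp
  ring

/-- This reads the degree and top coefficient of a transfer matrix entry off its growth. A larger
degree would make the leading coefficient equal to the limit 0. -/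
theorem natDegree_le_and_coeff {Q : ℂ[X]} {k : ℕ} (h : ScaledLimit (fun x => Q.eval x) (-k) c) :
    Q.natDegree ≤ k ∧ Q.coeff k = c := by
  have h1 : Q.natDegree ≤ k := by
    by_contra! hlt
    have h2 := (polynomial_eval Q le_rfl).unique (h.of_lt (by omega))
    rw [coeff_natDegree, leadingCoeff_eq_zero] at h2
    simp [h2] at hlt
  exact ⟨h1, (polynomial_eval Q h1).unique h⟩

theorem linear (a b : ℂ) : ScaledLimit (fun x => a + b * x) (-1) b := by
  refine ((polynomial_eval (C a + C b * X) (k := 1) (by compute_degree)).cast (by simp)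
    ?_).congr' (.of_forall fun x => by simp)
  simp [coeff_C]

end ScaledLimit

/-! ### Orders at infinity of S₊, S₋, p_n and q_n -/

namespace Params

variable {P : Params} {α β a₀ : ℂ} {p : ℕ → ℂ[X]}

theorem scaledLimit_specPlus (P : Params) :
    ScaledLimit (fun x => P.specPlus.eval x) (-3) (-(P.b₆ ^ 2 * P.b₁ * P.b₄)) := by
  refine ((((ScaledLimit.linear 1 (-P.b₁)).mul (.linear 1 (-P.b₄))).mul
    (.linear P.t (-P.b₆))).const_mul P.b₆).cast (by norm_num) (by ring) |>.congr' ?_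
  exact .of_forall fun x => by simp only [specPlus_eval]; ring

theorem scaledLimit_specMinus (P : Params) :
    ScaledLimit (fun x => P.specMinus.eval x) (-3) (-(P.b₂ * P.b₃)) := by
  refine (((ScaledLimit.linear 1 (-P.b₂)).mul (.linear 1 (-P.b₃))).mul
    (.linear (P.b₆ * P.t) (-1))).cast (by norm_num) (by ring) |>.congr' ?_
  exact .of_forall fun x => by simp only [specMinus_eval]; ring

theorem IsOrthonormal.recCoeff_ne_zero (hp : P.IsOrthonormal α β p) (ha₀ : a₀ ≠ 0) (n : ℕ) :
    recCoeff a₀ p n ≠ 0 := by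
  cases n with
  | zero => exact ha₀
  | succ n =>
    exact div_ne_zero (leadingCoeff_ne_zero.mpr (hp.ne_zero n))
      (leadingCoeff_ne_zero.mpr (hp.ne_zero (n + 1)))

theorem IsOrthonormal.scaledLimit_eval (hp : P.IsOrthonormal α β p) (n : ℕ) :
    ScaledLimit (fun x => (p n).eval x) (-n) (p n).leadingCoeff := by
  have := ScaledLimit.polynomial_eval (p n) (hp.natDegree_eq n).le
  rwa [leadingCoeff, hp.natDegree_eq]

theorem IsOrthonormal.scaledLimit_assoc (hq1 : ‖P.q‖ < 1) (hp : P.IsOrthonormal α β p) (n : ℕ) :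
    ScaledLimit (P.assoc α β p n) (n + 1) ((p n).leadingCoeff)⁻¹ :=
  (hp.tendsto_pow_mul_assoc hq1 n).congr fun x => by norm_cast

theorem IsOrthonormal.exists_scaledLimit_prev (hp : P.IsOrthonormal α β p) (n : ℕ) :
    ∃ c, ScaledLimit (fun x => (prev p n).eval x) (1 - n) c := by
  cases n with
  | zero => exact ⟨0, by simp [ScaledLimit, prev]⟩
  | succ n => exact ⟨_, (hp.scaledLimit_eval n).cast (by push_cast; ring) rfl⟩

theorem IsOrthonormal.scaledLimit_assocPrev (hq1 : ‖P.q‖ < 1) (hp : P.IsOrthonormal α β p)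
    (n : ℕ) : ScaledLimit (P.assocPrev α β a₀ p n) n
      (recCoeff a₀ p n * (p n).leadingCoeff)⁻¹ := by
  cases n with
  | zero => simp [ScaledLimit, assocPrev, recCoeff]
  | succ n =>
    refine (hp.scaledLimit_assoc hq1 n).cast (by push_cast; ring) ?_
    rw [recCoeff, div_mul_cancel₀ _ (leadingCoeff_ne_zero.mpr (hp.ne_zero (n + 1)))]

/-! ### The transfer matrix -/

variable (P α β a₀ p) in
/-- `D` is the inhomogeneity in the Pearson equation of the Stieltjes function `f`, and `r n`, `s n`
are the polynomials with `q_n = p_n f + r n` and `q_{n-1} = p_{n-1} f + s n`. -/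
structure IsRemainder (D : ℂ[X]) (r s : ℕ → ℂ[X]) : Prop where
  eval_zero : D.eval 0 = 0
  pearson : ∀ x, x ≠ 0 ∧ x ∉ support P.q α β →
    P.specMinus.eval x * P.stieltjes α β (P.q * x) -
      P.specPlus.eval x * P.stieltjes α β x = D.eval x
  assoc_eq : ∀ n x, x ≠ 0 ∧ x ∉ support P.q α β →
    P.assoc α β p n x = (p n).eval x * P.stieltjes α β x + (r n).eval x
  assocPrev_eq : ∀ n x, x ≠ 0 ∧ x ∉ support P.q α β →
    P.assocPrev α β a₀ p n x = (prev p n).eval x * P.stieltjes α β x + (s n).eval x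
  succ : ∀ n, s (n + 1) = r n

theorem exists_isRemainder (hq0 : P.q ≠ 0) (hq1 : ‖P.q‖ < 1) (hb₆ : P.b₆ ≠ 0) (ht : P.t ≠ 0)
    (h : P.IsAdmissible α β) : ∃ D r s, P.IsRemainder α β a₀ p D r s := by
  obtain ⟨D, hD0, hD⟩ := exists_stieltjes_pearson hq0 hq1 hb₆ ht h
  choose r _ hr using fun n => exists_polynomial_jackson (α := α) (β := β) hq1
    (continuousAt_weight (P := P) hq1) (p n)
  refine ⟨D, r, fun n => n.casesOn (C (1 / (a₀ * (p 0).leadingCoeff))) r, hD0, hD, hr, ?_,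
    fun _ => rfl⟩
  rintro (_ | n) x hx
  · simp [assocPrev, prev]
  · exact hr n x hx

variable (P) in
/-- The polynomial that equals `S₋ q₁(qx) p₂(x) - S₊ p₁(qx) q₂(x)` if `qᵢ = pᵢ f + rᵢ`. -/
noncomputable def transferEntry (D p₁ r₁ p₂ r₂ : ℂ[X]) : ℂ[X] :=
  (D * p₁.comp (C P.q * X) + P.specMinus * r₁.comp (C P.q * X)) * p₂ -
    P.specPlus * p₁.comp (C P.q * X) * r₂

/-- With g = f(qx), the Pearson equation trades D for the values of f, so that only p and q remain.
-/
theorem transferEntry_eval {D p₁ r₁ p₂ r₂ : ℂ[X]} {x f g : ℂ}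
    (hD : P.specMinus.eval x * g - P.specPlus.eval x * f = D.eval x) :
    (P.transferEntry D p₁ r₁ p₂ r₂).eval x =
      P.specMinus.eval x * (p₁.eval (P.q * x) * g + r₁.eval (P.q * x)) * p₂.eval x -
        P.specPlus.eval x * p₁.eval (P.q * x) * (p₂.eval x * f + r₂.eval x) := by
  simp only [transferEntry, eval_sub, eval_mul, eval_add, eval_comp, eval_C, eval_X, ← hD]
  ring

namespace IsRemainder

variable {D : ℂ[X]} {r s : ℕ → ℂ[X]}

/-- The Stieltjes function cancels from p_n q_{n-1} - p_{n-1} q_n, which is therefore a polynomial.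
At infinity its first product tends to 1/a_n and its second is of order x⁻², so it is constant. -/
theorem casoratian (h : P.IsRemainder α β a₀ p D r s) (hq1 : ‖P.q‖ < 1)
    (hp : P.IsOrthonormal α β p) (n : ℕ) :
    p n * s n - prev p n * r n = C (recCoeff a₀ p n)⁻¹ := by
  obtain ⟨c, hc⟩ := hp.exists_scaledLimit_prev n
  have h1 := (hp.scaledLimit_eval n).mul (hp.scaledLimit_assocPrev (a₀ := a₀) hq1 n)
  have h2 := (hc.mul (hp.scaledLimit_assoc hq1 n)).of_lt (t := 0) (by omega)
  have h3 := (h1.cast (t := 0) (by omega) rfl).sub h2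
  have hl := leadingCoeff_ne_zero.mpr (hp.ne_zero n)
  have h4 : ScaledLimit (fun x => (p n * s n - prev p n * r n).eval x) (-(0 : ℕ))
      (recCoeff a₀ p n)⁻¹ := by
    refine (h3.cast (by simp) ?_).congr' ?_
    · rw [mul_inv]; field_simp; ring
    filter_upwards [eventually_notMem_support (α := α) (β := β) hq1] with x hx
    rw [h.assoc_eq n x hx, h.assocPrev_eq n x hx]
    simp only [eval_sub, eval_mul]
    ring
  obtain ⟨h5, h6⟩ := h4.natDegree_le_and_coeff
  rw [eq_C_of_natDegree_le_zero h5, h6]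

variable (P a₀ p D r s) in
/-- The upper left entry of the transfer matrix. -/
noncomputable def T₁₁ (n : ℕ) : ℂ[X] :=
  -(C (recCoeff a₀ p n) * P.transferEntry D (p n) (r n) (prev p n) (s n))

variable (P a₀ p D r s) in
/-- The upper right entry of the transfer matrix. -/
noncomputable def T₁₂ (n : ℕ) : ℂ[X] :=
  C (recCoeff a₀ p n) * P.transferEntry D (p n) (r n) (p n) (r n)

variable (P a₀ p D r s) in
/-- The lower left entry of the transfer matrix. -/
noncomputable def T₂₁ (n : ℕ) : ℂ[X] :=
  -(C (recCoeff a₀ p n) * P.transferEntry D (prev p n) (s n) (prev p n) (s n))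

variable (P a₀ p D r s) in
/-- The lower right entry of the transfer matrix. -/
noncomputable def T₂₂ (n : ℕ) : ℂ[X] :=
  C (recCoeff a₀ p n) * P.transferEntry D (prev p n) (s n) (p n) (r n)

/-- The determinant is S₊ S₋ times a_n² times the Casoratians at x and at qx, each of which is
1/a_n. -/
theorem det (h : P.IsRemainder α β a₀ p D r s) (hq1 : ‖P.q‖ < 1)
    (hp : P.IsOrthonormal α β p) (ha₀ : a₀ ≠ 0) (n : ℕ) :
    T₁₁ P a₀ p D r s n * T₂₂ P a₀ p D r s n - T₁₂ P a₀ p D r n * T₂₁ P a₀ p D s n =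
      P.specPlus * P.specMinus := by
  have h1 := h.casoratian hq1 hp n
  have h2 := congrArg (fun u : ℂ[X] => u.comp (C P.q * X)) h1
  simp only [sub_comp, mul_comp, C_comp] at h2
  have ha : C (recCoeff a₀ p n) * C (recCoeff a₀ p n)⁻¹ = (1 : ℂ[X]) := by
    rw [← C_mul, mul_inv_cancel₀ (hp.recCoeff_ne_zero ha₀ n), C_1]
  simp only [T₁₁, T₂₂, T₁₂, T₂₁, transferEntry]
  rw [← h2] at ha
  have ha' := ha
  rw [h2, ← h1] at ha'
  linear_combination P.specPlus * P.specMinus * (ha + C (recCoeff a₀ p n) *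
    ((p n).comp (C P.q * X) * (s n).comp (C P.q * X) -
      (prev p n).comp (C P.q * X) * (r n).comp (C P.q * X)) * ha')

/-- At the fixed point 0 of the lattice D vanishes and S₊ = S₋ = b₆t, so only a Casoratian-like term
survives. This makes T(0) scalar, and the off-diagonal entries and T₁₁ - T₂₂ divisible by x. -/
theorem transferEntry_eval_zero (h : P.IsRemainder α β a₀ p D r s) (p₁ r₁ p₂ r₂ : ℂ[X]) :
    (P.transferEntry D p₁ r₁ p₂ r₂).eval 0 =
      P.b₆ * P.t * (r₁.eval 0 * p₂.eval 0 - p₁.eval 0 * r₂.eval 0) := by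
  simp [transferEntry, eval_comp, h.eval_zero, specPlus_eval, specMinus_eval]
  ring

theorem T₁₁_eval_zero (h : P.IsRemainder α β a₀ p D r s) (hq1 : ‖P.q‖ < 1)
    (hp : P.IsOrthonormal α β p) (ha₀ : a₀ ≠ 0) (n : ℕ) :
    (T₁₁ P a₀ p D r s n).eval 0 = P.b₆ * P.t := by
  have h1 := congrArg (fun u : ℂ[X] => u.eval 0) (h.casoratian hq1 hp n)
  simp only [eval_sub, eval_mul, eval_C] at h1
  have ha := mul_inv_cancel₀ (hp.recCoeff_ne_zero ha₀ n)
  simp only [T₁₁, eval_neg, eval_mul, eval_C, h.transferEntry_eval_zero]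
  rw [← h1] at ha
  linear_combination P.b₆ * P.t * ha

theorem T₂₂_eval_zero (h : P.IsRemainder α β a₀ p D r s) (hq1 : ‖P.q‖ < 1)
    (hp : P.IsOrthonormal α β p) (ha₀ : a₀ ≠ 0) (n : ℕ) :
    (T₂₂ P a₀ p D r s n).eval 0 = P.b₆ * P.t := by
  have h1 := congrArg (fun u : ℂ[X] => u.eval 0) (h.casoratian hq1 hp n)
  simp only [eval_sub, eval_mul, eval_C] at h1
  have ha := mul_inv_cancel₀ (hp.recCoeff_ne_zero ha₀ n)
  simp only [T₂₂, eval_mul, eval_C, h.transferEntry_eval_zero]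
  rw [← h1] at ha
  linear_combination P.b₆ * P.t * ha

theorem transferEntry_self_eval_zero (h : P.IsRemainder α β a₀ p D r s) (p₁ r₁ : ℂ[X]) :
    (P.transferEntry D p₁ r₁ p₁ r₁).eval 0 = 0 := by
  rw [h.transferEntry_eval_zero]
  ring

theorem eventually_good (hq0 : P.q ≠ 0) (hq1 : ‖P.q‖ < 1) : ∀ᶠ x in cobounded ℂ,
    (x ≠ 0 ∧ x ∉ support P.q α β) ∧ P.q * x ≠ 0 ∧ P.q * x ∉ support P.q α β :=
  (eventually_notMem_support hq1).and
    ((tendsto_mul_left_cobounded hq0).eventually (eventually_notMem_support hq1))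

/-- Only S₊(x) p_n(qx) q_{n-1}(x) reaches order x³, and p_n(qx) contributes q^n; the other product
has order x. -/
theorem T₁₁_degree (h : P.IsRemainder α β a₀ p D r s) (hq0 : P.q ≠ 0) (hq1 : ‖P.q‖ < 1)
    (hp : P.IsOrthonormal α β p) (ha₀ : a₀ ≠ 0) (n : ℕ) :
    (T₁₁ P a₀ p D r s n).natDegree ≤ 3 ∧
      (T₁₁ P a₀ p D r s n).coeff 3 = -(P.b₆ ^ 2 * P.b₁ * P.b₄ * P.q ^ n) := by
  have ha := hp.recCoeff_ne_zero ha₀ n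
  have hl := leadingCoeff_ne_zero.mpr (hp.ne_zero n)
  obtain ⟨c, hc⟩ := hp.exists_scaledLimit_prev n
  have h1 := ((((scaledLimit_specMinus P).mul
    ((hp.scaledLimit_assoc hq1 n).comp_mul hq0)).mul hc).of_lt (t := -3) (by omega))
  have h2 := (((scaledLimit_specPlus P).mul ((hp.scaledLimit_eval n).comp_mul hq0)).mul
    (hp.scaledLimit_assocPrev (a₀ := a₀) hq1 n)).cast (t := -3) (by omega) rfl
  refine ScaledLimit.natDegree_le_and_coeff
    (((h1.sub h2).const_mul (-recCoeff a₀ p n)).cast (by simp) ?_ |>.congr' ?_)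
  · simp only [neg_neg, zpow_natCast]
    field_simp
    ring
  · filter_upwards [eventually_good (α := α) (β := β) hq0 hq1] with x hx
    rw [h.assoc_eq n _ hx.2, h.assocPrev_eq n _ hx.1]
    simp only [T₁₁, eval_neg, eval_mul, eval_C, transferEntry_eval (h.pearson x hx.1)]
    ring

theorem T₂₂_degree (h : P.IsRemainder α β a₀ p D r s) (hq0 : P.q ≠ 0) (hq1 : ‖P.q‖ < 1)
    (hp : P.IsOrthonormal α β p) (ha₀ : a₀ ≠ 0) (n : ℕ) :
    (T₂₂ P a₀ p D r s n).natDegree ≤ 3 ∧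
      (T₂₂ P a₀ p D r s n).coeff 3 = -(P.b₂ * P.b₃ / P.q ^ n) := by
  have ha := hp.recCoeff_ne_zero ha₀ n
  have hl := leadingCoeff_ne_zero.mpr (hp.ne_zero n)
  obtain ⟨c, hc⟩ := hp.exists_scaledLimit_prev n
  have h1 := ((scaledLimit_specMinus P).mul
    ((hp.scaledLimit_assocPrev (a₀ := a₀) hq1 n).comp_mul hq0)).mul (hp.scaledLimit_eval n)
    |>.cast (t := -3) (by omega) rfl
  have h2 := (((scaledLimit_specPlus P).mul (hc.comp_mul hq0)).mul
    (hp.scaledLimit_assoc hq1 n)).of_lt (t := -3) (by omega)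
  refine ScaledLimit.natDegree_le_and_coeff
    (((h1.sub h2).const_mul (recCoeff a₀ p n)).cast (by simp) ?_ |>.congr' ?_)
  · simp only [zpow_neg, zpow_natCast]
    field_simp
    ring
  · filter_upwards [eventually_good (α := α) (β := β) hq0 hq1] with x hx
    rw [h.assoc_eq n _ hx.1, h.assocPrev_eq n _ hx.2]
    simp only [T₂₂, eval_mul, eval_C, transferEntry_eval (h.pearson x hx.1)]

/-- Both products have order x²: p_n(qx) contributes q^n and q_n(qx) contributes q^(-n-1). -/
theorem T₁₂_degree (h : P.IsRemainder α β a₀ p D r s) (hq0 : P.q ≠ 0) (hq1 : ‖P.q‖ < 1)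
    (hp : P.IsOrthonormal α β p) (n : ℕ) :
    (T₁₂ P a₀ p D r n).natDegree ≤ 2 ∧ (T₁₂ P a₀ p D r n).coeff 2 =
      recCoeff a₀ p n * (P.b₆ ^ 2 * P.b₁ * P.b₄ * P.q ^ n - P.b₂ * P.b₃ / P.q ^ (n + 1)) := by
  have hl := leadingCoeff_ne_zero.mpr (hp.ne_zero n)
  have h1 := ((scaledLimit_specMinus P).mul
    ((hp.scaledLimit_assoc hq1 n).comp_mul hq0)).mul (hp.scaledLimit_eval n)
    |>.cast (t := -2) (by omega) rfl
  have h2 := (((scaledLimit_specPlus P).mul ((hp.scaledLimit_eval n).comp_mul hq0)).mul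
    (hp.scaledLimit_assoc hq1 n)).cast (t := -2) (by omega) rfl
  refine ScaledLimit.natDegree_le_and_coeff
    (((h1.sub h2).const_mul (recCoeff a₀ p n)).cast (by simp) ?_ |>.congr' ?_)
  · have : P.q ^ (-((n : ℤ) + 1)) = (P.q ^ (n + 1))⁻¹ := by
      rw [zpow_neg]; norm_cast
    simp only [this, neg_neg, zpow_natCast]
    field_simp
    ring
  · filter_upwards [eventually_good (α := α) (β := β) hq0 hq1] with x hx
    rw [h.assoc_eq n _ hx.1, h.assoc_eq n _ hx.2]
    simp only [T₁₂, eval_mul, eval_C, transferEntry_eval (h.pearson x hx.1)]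

theorem T₂₁_natDegree_le (h : P.IsRemainder α β a₀ p D r s) (hq0 : P.q ≠ 0) (hq1 : ‖P.q‖ < 1)
    (hp : P.IsOrthonormal α β p) (n : ℕ) : (T₂₁ P a₀ p D s n).natDegree ≤ 2 := by
  obtain ⟨c, hc⟩ := hp.exists_scaledLimit_prev n
  have h1 := ((scaledLimit_specMinus P).mul
    ((hp.scaledLimit_assocPrev (a₀ := a₀) hq1 n).comp_mul hq0)).mul hc
    |>.cast (t := -2) (by omega) rfl
  have h2 := (((scaledLimit_specPlus P).mul (hc.comp_mul hq0)).mul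
    (hp.scaledLimit_assocPrev (a₀ := a₀) hq1 n)).cast (t := -2) (by omega) rfl
  refine (ScaledLimit.natDegree_le_and_coeff
    (((h1.sub h2).const_mul (-recCoeff a₀ p n)).cast (by simp) rfl |>.congr' ?_)).1
  filter_upwards [eventually_good (α := α) (β := β) hq0 hq1] with x hx
  rw [h.assocPrev_eq n _ hx.1, h.assocPrev_eq n _ hx.2]
  simp only [T₂₁, eval_neg, eval_mul, eval_C, transferEntry_eval (h.pearson x hx.1)]
  ring

variable (P a₀ p D r s) in
/-- The transfer matrix at a point. -/
noncomputable def transfer (n : ℕ) (x : ℂ) : Matrix (Fin 2) (Fin 2) ℂ :=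
  !![(T₁₁ P a₀ p D r s n).eval x, (T₁₂ P a₀ p D r n).eval x;
     (T₂₁ P a₀ p D s n).eval x, (T₂₂ P a₀ p D r s n).eval x]

theorem casoratian_eval (h : P.IsRemainder α β a₀ p D r s) (hq1 : ‖P.q‖ < 1)
    (hp : P.IsOrthonormal α β p) (ha₀ : a₀ ≠ 0) (n : ℕ) {x : ℂ}
    (hx : x ≠ 0 ∧ x ∉ support P.q α β) :
    recCoeff a₀ p n * ((p n).eval x * P.assocPrev α β a₀ p n x -
      (prev p n).eval x * P.assoc α β p n x) = 1 := by
  have h1 := congrArg (fun u : ℂ[X] => u.eval x) (h.casoratian hq1 hp n)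
  simp only [eval_sub, eval_mul, eval_C] at h1
  have ha := mul_inv_cancel₀ (hp.recCoeff_ne_zero ha₀ n)
  rw [← h1] at ha
  rw [h.assoc_eq n x hx, h.assocPrev_eq n x hx]
  linear_combination ha

theorem isUnit_det_Y (h : P.IsRemainder α β a₀ p D r s) (hq1 : ‖P.q‖ < 1)
    (hp : P.IsOrthonormal α β p) (ha₀ : a₀ ≠ 0) (n : ℕ) {x : ℂ} (hx : P.IsRegularPoint α β x) :
    IsUnit (P.Y α β a₀ p n x).det := by
  obtain ⟨hs, hn, hd⟩ := hx.2 x (by simp)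
  have h1 := h.casoratian_eval hq1 hp ha₀ n ⟨hx.1, hs⟩
  have hw : P.weight x ≠ 0 := div_ne_zero hn hd
  rw [isUnit_iff_ne_zero, Y, Matrix.det_fin_two_of]
  intro h2
  have h3 : (p n).eval x * P.assocPrev α β a₀ p n x -
      (prev p n).eval x * P.assoc α β p n x = 0 := by
    field_simp at h2
    linear_combination h2
  rw [h3, mul_zero] at h1
  exact zero_ne_one h1

/-- The first column is the Casoratian identity. In the second, division by w turns S₋ q_n(qx)/w(x)
into S₊ q_n(qx)/w(qx) by the Pearson equation. -/
theorem transfer_mul_Y (h : P.IsRemainder α β a₀ p D r s) (hq0 : P.q ≠ 0) (hq1 : ‖P.q‖ < 1)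
    (hb₆ : P.b₆ ≠ 0) (ht : P.t ≠ 0)
    (hp : P.IsOrthonormal α β p) (ha₀ : a₀ ≠ 0) (n : ℕ) {x : ℂ} (hx : P.IsRegularPoint α β x) :
    transfer P a₀ p D r s n x * P.Y α β a₀ p n x =
      P.specPlus.eval x • P.Y α β a₀ p n (P.q * x) := by
  obtain ⟨hs, hn, hd⟩ := hx.2 x (by simp)
  obtain ⟨hs', hn', hd'⟩ := hx.2 (P.q * x) (by simp)
  have hw : P.weight x ≠ 0 := div_ne_zero hn hd
  have hw' : P.weight (P.q * x) ≠ 0 := div_ne_zero hn' hd'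
  have h1 := h.casoratian_eval hq1 hp ha₀ n ⟨hx.1, hs⟩
  have h2 := specMinus_mul_weight hq1 hb₆ ht hd
  have hD := h.pearson x ⟨hx.1, hs⟩
  have e1 := h.assoc_eq n x ⟨hx.1, hs⟩
  have e2 := h.assocPrev_eq n x ⟨hx.1, hs⟩
  have e3 := h.assoc_eq n (P.q * x) ⟨mul_ne_zero hq0 hx.1, hs'⟩
  have e4 := h.assocPrev_eq n (P.q * x) ⟨mul_ne_zero hq0 hx.1, hs'⟩
  simp only [transfer, Y, T₁₁, T₁₂, T₂₁, T₂₂, eval_neg, eval_mul, eval_C, transferEntry_eval hD,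
    ← e1, ← e2, ← e3, ← e4]
  generalize P.assoc α β p n x = A₁ at *
  generalize P.assocPrev α β a₀ p n x = A₂ at *
  generalize P.assoc α β p n (P.q * x) = A₃ at *
  generalize P.assocPrev α β a₀ p n (P.q * x) = A₄ at *
  ext i j
  fin_cases i <;> fin_cases j
  · simp
    linear_combination P.specPlus.eval x * (p n).eval (P.q * x) * h1
  · simp
    field_simp
    linear_combination P.specMinus.eval x * A₃ * P.weight (P.q * x) * h1 + A₃ * h2
  · simp
    linear_combination P.specPlus.eval x * (prev p n).eval (P.q * x) * h1
  · simp
    field_simp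
    linear_combination P.specMinus.eval x * A₄ * P.weight (P.q * x) * h1 + A₄ * h2

end IsRemainder

end Params

/-! ### Spectral matrix and transfer matrix -/

section algebra

variable {R : Type*} [CommRing R]

/-- The spectral matrix determines the transfer matrix. -/
theorem transfer_eq_of_spectral_eq [IsDomain R] {W V d a w Ω Θ Θ' t₁₁ t₁₂ t₂₁ t₂₂ : R}
    (h2 : (2 : R) ≠ 0) (hV : V ≠ 0) (hd : d ≠ 0) (hw : w ≠ 0) (hS : W + d * V ≠ 0)
    (hdet : t₁₁ * t₂₂ - t₁₂ * t₂₁ = (W + d * V) * (W - d * V))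
    (e₁₁ : (2 * w - d * Ω) * t₁₁ + d * a * Θ * t₂₁ = (W + d * V) * (2 * w + d * Ω))
    (e₁₂ : (2 * w - d * Ω) * t₁₂ + d * a * Θ * t₂₂ = (W + d * V) * (-(d * a * Θ)))
    (e₂₁ : -(d * a * Θ') * t₁₁ + (2 * w + d * (Ω + 2 * V)) * t₂₁ = (W + d * V) * (d * a * Θ'))
    (e₂₂ : -(d * a * Θ') * t₁₂ + (2 * w + d * (Ω + 2 * V)) * t₂₂ =
      (W + d * V) * (2 * w - d * (Ω + 2 * V))) :
    t₁₁ = 2 * w - W + d * (V + Ω) ∧ t₁₂ = -(d * a * Θ) ∧ t₂₁ = d * a * Θ' ∧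
      t₂₂ = 2 * w - W - d * (V + Ω) := by
  -- With A the spectral numerator matrix, this says 4w² + d² det A = 4wW. It comes from the
  -- determinants of (2w - dA) T = S₊ (2w + dA), where tr A = -2V leaves the factor 2dV(W + dV) to
  -- cancel; hence V ≠ 0.
  have hδ : 4 * w ^ 2 + d ^ 2 * (-(Ω * (Ω + 2 * V)) + a ^ 2 * Θ * Θ') = 4 * w * W := by
    have h1 : (2 * d * V * (W + d * V)) *
        (4 * w * W - (4 * w ^ 2 + d ^ 2 * (-(Ω * (Ω + 2 * V)) + a ^ 2 * Θ * Θ'))) = 0 := by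
      linear_combination ((W + d * V) * (2 * w - d * (Ω + 2 * V))) * e₁₁ +
        ((2 * w - d * Ω) * t₁₁ + d * a * Θ * t₂₁) * e₂₂ - ((W + d * V) * (d * a * Θ')) * e₁₂ -
        ((2 * w - d * Ω) * t₁₂ + d * a * Θ * t₂₂) * e₂₁ -
        ((2 * w - d * Ω) * (2 * w + d * (Ω + 2 * V)) + d ^ 2 * a ^ 2 * Θ * Θ') * hdet
    have h3 := (mul_eq_zero.mp h1).resolve_left
      (mul_ne_zero (mul_ne_zero (mul_ne_zero h2 hd) hV) hS)
    linear_combination -h3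
  -- Consequently det(2w - dA) = 4w(W + dV), and multiplying the system by the adjugate of 2w - dA
  -- solves for T.
  have hc : 2 * 2 * w * (W + d * V) ≠ 0 :=
    mul_ne_zero (mul_ne_zero (mul_ne_zero h2 h2) hw) hS
  refine ⟨mul_left_cancel₀ hc ?_, mul_left_cancel₀ hc ?_, mul_left_cancel₀ hc ?_,
    mul_left_cancel₀ hc ?_⟩
  · linear_combination (2 * w + d * (Ω + 2 * V)) * e₁₁ - (d * a * Θ) * e₂₁ -
      (t₁₁ + W + d * V) * hδ
  · linear_combination (2 * w + d * (Ω + 2 * V)) * e₁₂ - (d * a * Θ) * e₂₂ - t₁₂ * hδ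
  · linear_combination (d * a * Θ') * e₁₁ + (2 * w - d * Ω) * e₂₁ - t₂₁ * hδ
  · linear_combination (d * a * Θ') * e₁₂ + (2 * w - d * Ω) * e₂₂ - (t₂₂ + W + d * V) * hδ

/-- The spectral equation follows from the expression of the transfer matrix. -/
theorem spectral_eq_of_transfer_eq {W V d a w Ω Θ Θ' : R}
    (hdet : (2 * w - W + d * (V + Ω)) * (2 * w - W - d * (V + Ω)) + d * a * Θ * (d * a * Θ') =
      (W + d * V) * (W - d * V)) :
    ((2 * w - d * Ω) * (2 * w - W + d * (V + Ω)) + d * a * Θ * (d * a * Θ') =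
      (W + d * V) * (2 * w + d * Ω)) ∧
    (-(d * a * Θ') * (-(d * a * Θ)) + (2 * w + d * (Ω + 2 * V)) * (2 * w - W - d * (V + Ω)) =
      (W + d * V) * (2 * w - d * (Ω + 2 * V))) :=
  ⟨by linear_combination hdet, by linear_combination hdet⟩

end algebra

/-- Clearing denominators puts the divided-difference equation in Cayley form. -/
theorem divided_difference_eq_iff {Y₀ Y₁ A : Matrix (Fin 2) (Fin 2) ℂ} {d w : ℂ} (hd : d ≠ 0)
    (hw : w ≠ 0) :
    d⁻¹ • (Y₁ - Y₀) = w⁻¹ • (A * ((2 : ℂ)⁻¹ • (Y₁ + Y₀))) ↔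
      ((2 * w) • 1 - d • A) * Y₁ = ((2 * w) • 1 + d • A) * Y₀ := by
  have h : (2 * w * d) • (d⁻¹ • (Y₁ - Y₀) - w⁻¹ • (A * ((2 : ℂ)⁻¹ • (Y₁ + Y₀)))) =
      ((2 * w) • 1 - d • A) * Y₁ - ((2 * w) • 1 + d • A) * Y₀ := by
    simp only [smul_sub, smul_smul, Matrix.mul_smul, Matrix.mul_add, Matrix.sub_mul,
      Matrix.add_mul, Matrix.smul_mul, Matrix.one_mul, smul_add]
    rw [show 2 * w * d * d⁻¹ = 2 * w by field_simp,
      show 2 * w * d * (w⁻¹ * 2⁻¹) = d by field_simp]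
    module
  rw [← sub_eq_zero, ← sub_eq_zero (a := _ * Y₁), ← h, smul_eq_zero_iff_right]
  exact mul_ne_zero (mul_ne_zero two_ne_zero hw) hd

/-- The spectral equation in terms of a transfer matrix `T`. -/
theorem divided_difference_eq_iff_transfer {Y₀ Y₁ A T : Matrix (Fin 2) (Fin 2) ℂ} {d w S : ℂ}
    (hd : d ≠ 0) (hw : w ≠ 0) (hS : S ≠ 0) (hY : IsUnit Y₀.det) (hT : T * Y₀ = S • Y₁) :
    d⁻¹ • (Y₁ - Y₀) = w⁻¹ • (A * ((2 : ℂ)⁻¹ • (Y₁ + Y₀))) ↔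
      ((2 * w) • 1 - d • A) * T = S • ((2 * w) • 1 + d • A) := by
  rw [divided_difference_eq_iff hd hw]
  have h1 : ((2 * w) • 1 - d • A) * T * Y₀ = S • (((2 * w) • 1 - d • A) * Y₁) := by
    rw [Matrix.mul_assoc, hT, Matrix.mul_smul]
  constructor
  · intro h
    rw [h] at h1
    have h2 : ((2 * w) • 1 - d • A) * T * Y₀ = S • ((2 * w) • 1 + d • A) * Y₀ := by
      rw [h1, Matrix.smul_mul]
    have h3 := congrArg (· * Y₀⁻¹) h2
    simpa only [Matrix.mul_nonsing_inv_cancel_right _ _ hY] using h3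
  · intro h
    rw [h, Matrix.smul_mul] at h1
    exact (smul_right_injective _ hS h1).symm

theorem coeff_C_mul_X_mul (c : ℂ) (Q : ℂ[X]) (k : ℕ) :
    (C c * X * Q).coeff (k + 1) = c * Q.coeff k := by
  rw [mul_assoc, coeff_C_mul, coeff_X_mul]

theorem natDegree_le_of_C_mul_X_mul {c : ℂ} (hc : c ≠ 0) {Q : ℂ[X]} {k : ℕ}
    (h : (C c * X * Q).natDegree ≤ k + 1) : Q.natDegree ≤ k := by
  rw [natDegree_le_iff_coeff_eq_zero] at h ⊢
  intro m hm
  have := h (m + 1) (by omega)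
  rwa [coeff_C_mul_X_mul, mul_eq_zero, or_iff_right hc] at this

theorem eq_C_mul_X_mul_divX {c : ℂ} (hc : c ≠ 0) {Q : ℂ[X]} (h : Q.eval 0 = 0) :
    C c * X * (C c⁻¹ * Q.divX) = Q := by
  have h1 : C c * C c⁻¹ = (1 : ℂ[X]) := by rw [← C_mul, mul_inv_cancel₀ hc, C_1]
  have h2 := X_mul_divX_add Q
  rw [coeff_zero_eq_eval_zero, h, C_0, add_zero] at h2
  linear_combination X * Q.divX * h1 + h2

/-! ### Existence of spectral coefficients and their relation to the transfer matrix -/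

namespace Params

variable {P : Params} {α β a₀ : ℂ} {p : ℕ → ℂ[X]}

/-- The factor G absorbs the points where W_n vanishes, leaving an equality at infinitely many
points. -/
theorem eq_of_eval_eq_of_isRegularPoint (hq0 : P.q ≠ 0) (hq1 : ‖P.q‖ < 1) {G Q₁ Q₂ : ℂ[X]}
    (hG : G ≠ 0) (h : ∀ x, P.IsRegularPoint α β x → G.eval x ≠ 0 → Q₁.eval x = Q₂.eval x) :
    Q₁ = Q₂ := by
  refine mul_left_cancel₀ hG (eq_of_infinite_eval_eq _ _
    ((infinite_setOf_isRegularPoint (α := α) (β := β) hq0 hq1).mono fun x hx => ?_))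
  change (G * Q₁).eval x = (G * Q₂).eval x
  by_cases hx0 : G.eval x = 0
  · simp [hx0]
  · rw [eval_mul, eval_mul, h x hx hx0]

theorem IsRegularPoint.step_ne_zero (hq1 : ‖P.q‖ < 1) {x : ℂ} (hx : P.IsRegularPoint α β x) :
    P.q * x - x ≠ 0 := by
  rw [← sub_one_mul]
  exact mul_ne_zero (sub_ne_zero.mpr (q_ne_one hq1)) hx.1

theorem IsRegularPoint.specPlus_ne_zero (hq1 : ‖P.q‖ < 1) (hb₆ : P.b₆ ≠ 0) (ht : P.t ≠ 0)
    {x : ℂ} (hx : P.IsRegularPoint α β x) : P.specPlus.eval x ≠ 0 :=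
  (specPlus_ne_zero_of_weightDen hq1 hb₆ ht (hx.2 x (by simp)).2.2).1

theorem specPlus_ne_zero (hb₆ : P.b₆ ≠ 0) (ht : P.t ≠ 0) : P.specPlus ≠ 0 := by
  intro h
  have := specPlus_eval (P := P) 0
  rw [h] at this
  simp at this
  tauto

namespace IsRemainder

variable {D : ℂ[X]} {r s : ℕ → ℂ[X]}

/-- The half trace of T gives W_n, the half difference of its diagonal gives Ω_n + V, and T₁₂ gives
Θ_n. The entry T₂₁ is built from the data of index n - 1, so it yields Θ_{n-1}; at n = 0 it
vanishes, in agreement with Θ_{-1} = 0. -/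
theorem exists_isSpectralCoeffs (h : P.IsRemainder α β a₀ p D r s) (hq0 : P.q ≠ 0)
    (hq1 : ‖P.q‖ < 1) (hb₆ : P.b₆ ≠ 0) (ht : P.t ≠ 0) (hp : P.IsOrthonormal α β p)
    (ha₀ : a₀ ≠ 0) : ∃ Wn Ωn Θn : ℕ → ℂ[X], P.IsSpectralCoeffs α β a₀ p Wn Ωn Θn := by
  have hq : P.q - 1 ≠ 0 := sub_ne_zero.mpr (q_ne_one hq1)
  have h22 : (C 2⁻¹ : ℂ[X]) * 2 = 1 := by
    rw [show (2 : ℂ[X]) = C 2 from rfl, ← C_mul]; simp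
  obtain ⟨Θ, hΘ⟩ : ∃ Θ : ℕ → ℂ[X], ∀ n, C (P.q - 1) * X * Θ n =
      -P.transferEntry D (p n) (r n) (p n) (r n) :=
    ⟨_, fun n => eq_C_mul_X_mul_divX hq (by simp [h.transferEntry_self_eval_zero])⟩
  obtain ⟨Ψ, hΨ⟩ : ∃ Ψ : ℕ → ℂ[X], ∀ n, C (2 * (P.q - 1)) * X * Ψ n =
      T₁₁ P a₀ p D r s n - T₂₂ P a₀ p D r s n :=
    ⟨_, fun n => eq_C_mul_X_mul_divX (mul_ne_zero two_ne_zero hq)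
      (by simp [h.T₁₁_eval_zero hq1 hp ha₀, h.T₂₂_eval_zero hq1 hp ha₀])⟩
  set w : ℕ → ℂ[X] := fun n =>
    C 2⁻¹ * (C 2⁻¹ * (T₁₁ P a₀ p D r s n + T₂₂ P a₀ p D r s n) + P.W) with hw
  have hw2 (n : ℕ) : 2 * (2 * w n - P.W) = T₁₁ P a₀ p D r s n + T₂₂ P a₀ p D r s n := by
    simp only [hw]
    linear_combination (2 * (C 2⁻¹ * (T₁₁ P a₀ p D r s n + T₂₂ P a₀ p D r s n) + P.W) +
      (T₁₁ P a₀ p D r s n + T₂₂ P a₀ p D r s n)) * h22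
  have h2 : (2 : ℂ[X]) ≠ 0 := two_ne_zero
  have e₁₁ (n : ℕ) : T₁₁ P a₀ p D r s n = 2 * w n - P.W + C (P.q - 1) * X * Ψ n := by
    refine mul_left_cancel₀ h2 ?_
    have := hΨ n
    rw [C_mul, show (C 2 : ℂ[X]) = 2 from rfl] at this
    linear_combination -hw2 n - this
  have e₂₂ (n : ℕ) : T₂₂ P a₀ p D r s n = 2 * w n - P.W - C (P.q - 1) * X * Ψ n := by
    refine mul_left_cancel₀ h2 ?_
    have := hΨ n
    rw [C_mul, show (C 2 : ℂ[X]) = 2 from rfl] at this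
    linear_combination -hw2 n + this
  have e₁₂ (n : ℕ) : T₁₂ P a₀ p D r n =
      -(C (P.q - 1) * X * C (recCoeff a₀ p n) * Θ n) := by
    rw [T₁₂]
    linear_combination C (recCoeff a₀ p n) * hΘ n
  have e₂₁ (n : ℕ) : T₂₁ P a₀ p D s n =
      C (P.q - 1) * X * C (recCoeff a₀ p n) * prev Θ n := by
    rw [T₂₁]
    cases n with
    | zero => simp [prev, transferEntry]
    | succ n =>
      simp only [prev, h.succ]
      linear_combination -C (recCoeff a₀ p (n + 1)) * hΘ n
  refine ⟨w, fun n => Ψ n - P.V, Θ, fun n hn => ?_, fun n x hx hwx => ?_⟩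
  -- The trace at 0 gives W_n(0) = b₆t, so W_n = 0 is impossible.
  · have h1 := congrArg (fun u : ℂ[X] => u.eval 0) (hw2 n)
    simp only [hn, eval_mul, eval_sub, eval_add, h.T₁₁_eval_zero hq1 hp ha₀,
      h.T₂₂_eval_zero hq1 hp ha₀] at h1
    simp [W, specPlus_eval, specMinus_eval] at h1
    have h3 : P.b₆ * P.t = 0 := by linear_combination -h1 / 4
    exact mul_ne_zero hb₆ ht h3
  · refine (divided_difference_eq_iff_transfer (hx.step_ne_zero hq1) hwx
      (hx.specPlus_ne_zero hq1 hb₆ ht) (h.isUnit_det_Y hq1 hp ha₀ n hx)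
      (h.transfer_mul_Y hq0 hq1 hb₆ ht hp ha₀ n hx)).mpr ?_
    have hdet := h.det hq1 hp ha₀ n
    rw [← P.W_add_V (q_ne_one hq1), ← P.W_sub_V (q_ne_one hq1), e₁₁, e₂₂, e₁₂, e₂₁] at hdet
    have hdet' := congrArg (fun u : ℂ[X] => u.eval x) hdet
    rw [transfer, e₁₁, e₁₂, e₂₁, e₂₂, ← P.W_add_V (q_ne_one hq1)]
    simp only [eval_mul, eval_add, eval_sub, eval_neg, eval_C, eval_X, eval_ofNat] at hdet' ⊢
    obtain ⟨f₁, f₂⟩ := spectral_eq_of_transfer_eq (W := P.W.eval x) (V := P.V.eval x)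
      (d := (P.q - 1) * x) (a := recCoeff a₀ p n) (w := (w n).eval x)
      (Ω := (Ψ n).eval x - P.V.eval x) (Θ := (Θ n).eval x) (Θ' := (prev Θ n).eval x)
      (by linear_combination hdet')
    ext i j
    fin_cases i <;> fin_cases j <;> simp [Matrix.mul_apply, Fin.sum_univ_two]
    · linear_combination f₁
    · ring
    · ring
    · linear_combination f₂

theorem transfer_eq_of_isSpectralCoeffs (h : P.IsRemainder α β a₀ p D r s) (hq0 : P.q ≠ 0)
    (hq1 : ‖P.q‖ < 1) (hb₆ : P.b₆ ≠ 0) (ht : P.t ≠ 0) (hα : P.IsAdmissible α β)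
    (hp : P.IsOrthonormal α β p) (ha₀ : a₀ ≠ 0)
    {Wn Ωn Θn : ℕ → ℂ[X]} (hS : P.IsSpectralCoeffs α β a₀ p Wn Ωn Θn) (n : ℕ) :
    T₁₁ P a₀ p D r s n = 2 * Wn n - P.W + C (P.q - 1) * X * (P.V + Ωn n) ∧
    T₁₂ P a₀ p D r n = -(C (P.q - 1) * X * C (recCoeff a₀ p n) * Θn n) ∧
    T₂₁ P a₀ p D s n = C (P.q - 1) * X * C (recCoeff a₀ p n) * prev Θn n ∧
    T₂₂ P a₀ p D r s n = 2 * Wn n - P.W - C (P.q - 1) * X * (P.V + Ωn n) := by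
  have hd : C (P.q - 1) * X ≠ 0 :=
    mul_ne_zero (C_ne_zero.mpr (sub_ne_zero.mpr (q_ne_one hq1))) X_ne_zero
  have key (x : ℂ) (hx : P.IsRegularPoint α β x) (hw : (Wn n).eval x ≠ 0) :=
    (divided_difference_eq_iff_transfer (hx.step_ne_zero hq1) hw
      (hx.specPlus_ne_zero hq1 hb₆ ht) (h.isUnit_det_Y hq1 hp ha₀ n hx)
      (h.transfer_mul_Y hq0 hq1 hb₆ ht hp ha₀ n hx)).mp (hS.spectral_eq n x hx hw)
  have hdet := h.det hq1 hp ha₀ n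
  rw [← P.W_add_V (q_ne_one hq1), ← P.W_sub_V (q_ne_one hq1)] at hdet
  refine transfer_eq_of_spectral_eq two_ne_zero (V_ne_zero hq1 hb₆ ht hα) hd (hS.ne_zero n)
    (by rw [P.W_add_V (q_ne_one hq1)]; exact specPlus_ne_zero hb₆ ht) hdet ?_ ?_ ?_ ?_ <;>
  refine eq_of_eval_eq_of_isRegularPoint (α := α) (β := β) hq0 hq1 (hS.ne_zero n)
    fun x hx hw => ?_ <;>
  have h1 := key x hx hw <;>
  rw [transfer, ← P.W_add_V (q_ne_one hq1)] at h1 <;>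
  simp only [eval_mul, eval_add, eval_sub, eval_neg, eval_C, eval_X, eval_ofNat] at h1 ⊢
  · have h2 := congrFun (congrFun h1 0) 0
    simp [Matrix.mul_apply, Fin.sum_univ_two] at h2
    linear_combination h2
  · have h2 := congrFun (congrFun h1 0) 1
    simp [Matrix.mul_apply, Fin.sum_univ_two] at h2
    linear_combination h2
  · have h2 := congrFun (congrFun h1 1) 0
    simp [Matrix.mul_apply, Fin.sum_univ_two] at h2
    linear_combination h2
  · have h2 := congrFun (congrFun h1 1) 1
    simp [Matrix.mul_apply, Fin.sum_univ_two] at h2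
    linear_combination h2

end IsRemainder

end Params

/-- The coefficients of `x` and `x ^ 5` in the determinant of the transfer matrix. -/
theorem coeff_of_determinant {q b₁ b₂ b₃ b₄ b₆ t a n₀ n₁ n₂ n₃ z₀ z₁ z₂ e₀ e₁ f₀ f₁ : ℂ}
    (hb : b₁ * b₂ * b₃ * b₄ = 1)
    (h : ∀ x : ℂ, (n₀ + n₁ * x + n₂ * x ^ 2 + n₃ * x ^ 3) ^ 2 -
      ((q - 1) * x * (z₀ + z₁ * x + z₂ * x ^ 2)) ^ 2 +
      ((q - 1) * x * a) ^ 2 * ((e₀ + e₁ * x) * (f₀ + f₁ * x)) =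
      (b₆ * (1 - b₁ * x) * (1 - b₄ * x) * (t - b₆ * x)) *
        ((1 - b₂ * x) * (1 - b₃ * x) * (b₆ * t - x))) :
    2 * n₀ * n₁ = -(b₆ * t * (1 + (b₁ + b₂ + b₃ + b₄) * b₆ * t + b₆ ^ 2)) ∧
    2 * n₂ * n₃ - 2 * (q - 1) ^ 2 * z₁ * z₂ =
      -(b₆ * (t * (1 + b₆ ^ 2) + b₆ * (b₁⁻¹ + b₂⁻¹ + b₃⁻¹ + b₄⁻¹))) := by
  have he : b₁⁻¹ + b₂⁻¹ + b₃⁻¹ + b₄⁻¹ =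
      b₂ * b₃ * b₄ + b₁ * b₃ * b₄ + b₁ * b₂ * b₄ + b₁ * b₂ * b₃ := by
    rw [inv_eq_of_mul_eq_one_right (a := b₁) (b := b₂ * b₃ * b₄) (by linear_combination hb),
      inv_eq_of_mul_eq_one_right (a := b₂) (b := b₁ * b₃ * b₄) (by linear_combination hb),
      inv_eq_of_mul_eq_one_right (a := b₃) (b := b₁ * b₂ * b₄) (by linear_combination hb),
      inv_eq_of_mul_eq_one_right (a := b₄) (b := b₁ * b₂ * b₃) (by linear_combination hb)]
  rw [he]
  constructor
  -- Both sides have degree at most 6, so their odd parts involve only x, x³, x⁵. The central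
  -- differences at ±1, ±2, ±3 isolate the coefficient of x here and that of x⁵ below.
  · linear_combination (45 * (h 1 - h (-1)) - 9 * (h 2 - h (-2)) + (h 3 - h (-3))) / 60
  · linear_combination (5 * (h 1 - h (-1)) - 4 * (h 2 - h (-2)) + (h 3 - h (-3))) / 240 -
      b₆ * t * (1 + b₆ ^ 2) * hb

/-- The cubic `2 W_n - W` in terms of its value at a point `l`. -/
theorem cubic_interpolation {b₅ b₆ t σ n₀ n₁ n₂ n₃ l ν : ℂ} (hl : l ≠ 0)
    (h₀ : n₀ = b₆ * t) (h₁ : n₁ = -σ / 2)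
    (h₃ : n₃ = -(b₆ * (b₅ + b₅⁻¹)) / 2) (hν : ν = n₀ + n₁ * l + n₂ * l ^ 2 + n₃ * l ^ 3) (x : ℂ) :
    n₀ + n₁ * x + n₂ * x ^ 2 + n₃ * x ^ 3 = x ^ 2 * (ν / l ^ 2) + 1 / 2 * (x - l) *
      (-b₆ * (b₅ + b₅⁻¹) * x ^ 2 + σ / l * x - 2 * t * b₆ * ((x + l) / l ^ 2)) := by
  generalize b₅ + b₅⁻¹ = c at *
  subst h₀ h₁ h₃ hν
  field_simp
  ring

/-- The quadratic `Ω_n + V` in terms of its value at a point `l`. -/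
theorem quadratic_interpolation {q b₅ b₆ t σ e n₀ n₁ n₂ n₃ z₀ z₁ z₂ l ν μ : ℂ} (hl : l ≠ 0)
    (hq : 1 - q ≠ 0) (hb₅ : b₅ ≠ 0) (hb₆ : b₆ ≠ 0) (hb : 1 - b₅ ^ 2 ≠ 0)
    (h₀ : n₀ = b₆ * t) (h₁ : n₁ = -σ / 2) (h₃ : n₃ = -(b₆ * (b₅ + b₅⁻¹)) / 2)
    (hz : z₂ = -(b₆ * (1 - b₅ ^ 2)) / (2 * b₅ * (1 - q)))
    (h₅ : 2 * n₂ * n₃ - 2 * (q - 1) ^ 2 * z₁ * z₂ = -(b₆ * (t * (1 + b₆ ^ 2) + b₆ * e)))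
    (hν : ν = n₀ + n₁ * l + n₂ * l ^ 2 + n₃ * l ^ 3) (hμ : μ = z₀ + z₁ * l + z₂ * l ^ 2) (x : ℂ) :
    z₀ + z₁ * x + z₂ * x ^ 2 = μ + b₆ / (2 * b₅ * (1 - q) * (1 - b₅ ^ 2) * l ^ 2) * (x - l) *
      (-(1 - b₅ ^ 2) ^ 2 * l ^ 2 * x -
        2 * b₅ ^ 2 * (e + (b₆ + b₆⁻¹) * t - 2 * l) * l ^ 2 +
        b₅ * b₆⁻¹ * (1 + b₅ ^ 2) * (σ * l + 2 * ν - 2 * t * b₆)) := by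
  -- The x⁵ relation is solved for z₁; its factor z₂ is nonzero because b₅² ≠ 1.
  have hz₁ : z₁ = ((1 + b₅ ^ 2) * n₂ - b₅ * (t * (1 + b₆ ^ 2) + b₆ * e)) /
      ((1 - q) * (1 - b₅ ^ 2)) := by
    rw [eq_div_iff (mul_ne_zero hq hb)]
    rw [h₃, hz] at h₅
    field_simp at h₅
    refine mul_left_cancel₀ hq ?_
    linear_combination h₅
  subst hμ hν h₀ h₁ h₃ hz hz₁
  field_simp
  ring

theorem eval_eq_cubic {Q : ℂ[X]} (h : Q.natDegree ≤ 3) (x : ℂ) :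
    Q.eval x = Q.coeff 0 + Q.coeff 1 * x + Q.coeff 2 * x ^ 2 + Q.coeff 3 * x ^ 3 := by
  simp [eval_eq_sum_range' (Nat.lt_succ_of_le h), Finset.sum_range_succ]

theorem eval_eq_quadratic {Q : ℂ[X]} (h : Q.natDegree ≤ 2) (x : ℂ) :
    Q.eval x = Q.coeff 0 + Q.coeff 1 * x + Q.coeff 2 * x ^ 2 := by
  simp [eval_eq_sum_range' (Nat.lt_succ_of_le h), Finset.sum_range_succ]

theorem eval_eq_linear {Q : ℂ[X]} (h : Q.natDegree ≤ 1) (x : ℂ) :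
    Q.eval x = Q.coeff 0 + Q.coeff 1 * x := by
  simp [eval_eq_sum_range' (Nat.lt_succ_of_le h), Finset.sum_range_succ]

end DeformedBigQJacobi

/-! ### The main theorem -/

open DeformedBigQJacobi Params IsRemainder in
theorem mainTheorem5 (P : DeformedBigQJacobi.Params) (hq0 : P.q ≠ 0) (hq1 : ‖P.q‖ < 1)
    (hb : P.b₁ * P.b₂ * P.b₃ * P.b₄ = 1) (hb₆ : P.b₆ ≠ 0) (ht : P.t ≠ 0)
    (α β : ℂ) (hαβ : P.IsAdmissible α β)
    (p : ℕ → Polynomial ℂ) (hp : P.IsOrthonormal α β p) (a₀ : ℂ) (ha₀ : a₀ ≠ 0) :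
    (∃ Wn Ωn Θn : ℕ → Polynomial ℂ, P.IsSpectralCoeffs α β a₀ p Wn Ωn Θn) ∧
    ∀ Wn Ωn Θn : ℕ → Polynomial ℂ, P.IsSpectralCoeffs α β a₀ p Wn Ωn Θn →
      ∀ (n : ℕ) (b₅ : ℂ), P.q ^ n = b₅ / (P.b₁ * P.b₄ * P.b₆) →
        P.q * b₅ ^ 2 ≠ 1 → b₅ ^ 2 ≠ 1 →
        ∃ lam : ℂ, (∀ x, (Θn n).eval x = 0 ↔ x = lam) ∧
          ∀ ν μ : ℂ, ν = 2 * (Wn n).eval lam - P.W.eval lam →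
            μ = (Ωn n).eval lam + P.V.eval lam →
            (lam ≠ 0 → ∀ x : ℂ,
              2 * (Wn n).eval x - P.W.eval x =
                x ^ 2 * (ν / lam ^ 2) + 1 / 2 * (x - lam) *
                  (-P.b₆ * (b₅ + b₅⁻¹) * x ^ 2
                    + (1 + (P.b₁ + P.b₂ + P.b₃ + P.b₄) * P.b₆ * P.t + P.b₆ ^ 2) / lam * x
                    - 2 * P.t * P.b₆ * ((x + lam) / lam ^ 2))) ∧
            (lam ≠ 0 → ∀ x : ℂ,
              (Ωn n).eval x + P.V.eval x =
                μ + P.b₆ / (2 * b₅ * (1 - P.q) * (1 - b₅ ^ 2) * lam ^ 2) * (x - lam) *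
                  (-(1 - b₅ ^ 2) ^ 2 * lam ^ 2 * x
                    - 2 * b₅ ^ 2 *
                      (P.b₁⁻¹ + P.b₂⁻¹ + P.b₃⁻¹ + P.b₄⁻¹ + (P.b₆ + P.b₆⁻¹) * P.t - 2 * lam)
                      * lam ^ 2
                    + b₅ * P.b₆⁻¹ * (1 + b₅ ^ 2) *
                      ((1 + (P.b₁ + P.b₂ + P.b₃ + P.b₄) * P.b₆ * P.t + P.b₆ ^ 2) * lam
                        + 2 * ν - 2 * P.t * P.b₆))) ∧
            (∀ x : ℂ, (Θn n).eval x =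
              -(P.b₆ * (1 - P.q * b₅ ^ 2) / (P.q * (1 - P.q) * b₅)) * (x - lam)) ∧
            ν ^ 2 = (1 - P.q) ^ 2 * lam ^ 2 * μ ^ 2
              + P.b₆ * (P.b₁ * lam - 1) * (P.b₂ * lam - 1) * (P.b₃ * lam - 1) * (P.b₄ * lam - 1)
                * (lam - P.t * P.b₆) * (P.b₆ * lam - P.t) := by
  obtain ⟨D, r, s, h⟩ := exists_isRemainder (a₀ := a₀) (p := p) hq0 hq1 hb₆ ht hαβ
  refine ⟨h.exists_isSpectralCoeffs hq0 hq1 hb₆ ht hp ha₀, ?_⟩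
  intro Wn Ωn Θn hS n b₅ hb₅ hqb hbb
  have hq : P.q - 1 ≠ 0 := sub_ne_zero.mpr (q_ne_one hq1)
  have hq' : 1 - P.q ≠ 0 := sub_ne_zero.mpr (q_ne_one hq1).symm
  have hb₁ : P.b₁ ≠ 0 := by intro h; simp [h] at hb
  have hb₄ : P.b₄ ≠ 0 := by intro h; simp [h] at hb
  have hqn : P.q ^ n ≠ 0 := pow_ne_zero n hq0
  have ha := hp.recCoeff_ne_zero ha₀ n
  have hbeq : b₅ = P.q ^ n * (P.b₁ * P.b₄ * P.b₆) := by
    rw [hb₅]; field_simp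
  have hb₅0 : b₅ ≠ 0 := by
    rw [hbeq]; exact mul_ne_zero hqn (mul_ne_zero (mul_ne_zero hb₁ hb₄) hb₆)
  -- With b₅ = q^n b₁b₄b₆ and b₂b₃ = 1/(b₁b₄), the diagonal entries of T have x³ coefficients -b₆b₅
  -- and -b₆/b₅.
  have hl₁ : -(P.b₆ ^ 2 * P.b₁ * P.b₄ * P.q ^ n) = -(P.b₆ * b₅) := by
    rw [hbeq]; ring
  have hl₂ : P.b₂ * P.b₃ / P.q ^ n = P.b₆ / b₅ := by
    rw [hbeq]; field_simp; linear_combination hb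
  obtain ⟨e₁₁, e₁₂, e₂₁, e₂₂⟩ :=
    h.transfer_eq_of_isSpectralCoeffs hq0 hq1 hb₆ ht hαβ hp ha₀ hS n
  obtain ⟨d₁₁, c₁₁⟩ := h.T₁₁_degree hq0 hq1 hp ha₀ n
  obtain ⟨d₁₂, c₁₂⟩ := h.T₁₂_degree hq0 hq1 hp n
  have d₂₁ := h.T₂₁_natDegree_le hq0 hq1 hp n
  obtain ⟨d₂₂, c₂₂⟩ := h.T₂₂_degree hq0 hq1 hp ha₀ n
  have hdet := h.det hq1 hp ha₀ n
  have v₁₁ := h.T₁₁_eval_zero hq1 hp ha₀ n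
  have v₂₂ := h.T₂₂_eval_zero hq1 hp ha₀ n
  rw [hl₁] at c₁₁
  rw [hl₂] at c₂₂
  have hl₃ : P.b₆ ^ 2 * P.b₁ * P.b₄ * P.q ^ n - P.b₂ * P.b₃ / P.q ^ (n + 1) =
      -(P.b₆ * (1 - P.q * b₅ ^ 2)) / (P.q * b₅) := by
    have : P.b₂ * P.b₃ / P.q ^ (n + 1) = P.b₆ / b₅ / P.q := by rw [← hl₂, pow_succ, div_div]
    rw [this, ← neg_neg (P.b₆ ^ 2 * P.b₁ * P.b₄ * P.q ^ n), hl₁]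
    field_simp
    ring
  rw [hl₃] at c₁₂
  set N := 2 * Wn n - P.W with hN
  set Ψ := P.V + Ωn n with hΨ
  have hNe : C 2 * N = T₁₁ P a₀ p D r s n + T₂₂ P a₀ p D r s n := by
    rw [e₁₁, e₂₂, show (C 2 : ℂ[X]) = 2 from rfl]; ring
  have hΨe : C (2 * (P.q - 1)) * X * Ψ = T₁₁ P a₀ p D r s n - T₂₂ P a₀ p D r s n := by
    rw [e₁₁, e₂₂, C_mul, show (C 2 : ℂ[X]) = 2 from rfl]; ring
  have hΘe : C (-((P.q - 1) * recCoeff a₀ p n)) * X * Θn n = T₁₂ P a₀ p D r n := by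
    rw [e₁₂, C_neg, C_mul]; ring
  have hΘ'e : C ((P.q - 1) * recCoeff a₀ p n) * X * prev Θn n = T₂₁ P a₀ p D s n := by
    rw [e₂₁, C_mul]; ring
  have dN : N.natDegree ≤ 3 := by
    rw [← natDegree_C_mul (two_ne_zero (α := ℂ)), hNe]
    exact natDegree_add_le_of_degree_le d₁₁ d₂₂
  have h2q : 2 * (P.q - 1) ≠ 0 := mul_ne_zero two_ne_zero hq
  have haq : (P.q - 1) * recCoeff a₀ p n ≠ 0 := mul_ne_zero hq ha
  -- Dividing by Δy lowers each degree by one. That Θ_n and Θ_{n-1} are both at most linear keeps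
  -- their product out of the x⁵ coefficient.
  have dΨ : Ψ.natDegree ≤ 2 := natDegree_le_of_C_mul_X_mul h2q
    (by rw [hΨe]; exact natDegree_sub_le_of_le d₁₁ d₂₂)
  have dΘ : (Θn n).natDegree ≤ 1 := natDegree_le_of_C_mul_X_mul (neg_ne_zero.mpr haq)
    (by rw [hΘe]; exact d₁₂)
  have dΘ' : (prev Θn n).natDegree ≤ 1 := natDegree_le_of_C_mul_X_mul haq
    (by rw [hΘ'e]; exact d₂₁)
  have cN : N.coeff 3 = -(P.b₆ * (b₅ + b₅⁻¹)) / 2 := by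
    have := congrArg (fun u : ℂ[X] => u.coeff 3) hNe
    simp only [coeff_C_mul, coeff_add, c₁₁, c₂₂] at this
    rw [eq_div_iff two_ne_zero]
    linear_combination this
  have cN₀ : N.coeff 0 = P.b₆ * P.t := by
    have := congrArg (fun u : ℂ[X] => u.eval 0) hNe
    simp only [eval_mul, eval_C, eval_add, v₁₁, v₂₂] at this
    rw [coeff_zero_eq_eval_zero]
    linear_combination this / 2
  have cΨ : Ψ.coeff 2 = -(P.b₆ * (1 - b₅ ^ 2)) / (2 * b₅ * (1 - P.q)) := by
    have := congrArg (fun u : ℂ[X] => u.coeff 3) hΨe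
    simp only [coeff_C_mul_X_mul, coeff_sub, c₁₁, c₂₂] at this
    rw [eq_div_iff (mul_ne_zero (mul_ne_zero two_ne_zero hb₅0) hq')]
    field_simp at this
    linear_combination -this
  have cΘ : (Θn n).coeff 1 = -(P.b₆ * (1 - P.q * b₅ ^ 2) / (P.q * (1 - P.q) * b₅)) := by
    have := congrArg (fun u : ℂ[X] => u.coeff 2) hΘe
    simp only [coeff_C_mul_X_mul, c₁₂] at this
    refine mul_left_cancel₀ (neg_ne_zero.mpr haq) ?_
    rw [this]
    field_simp
    ring
  have hdet' (x : ℂ) : N.eval x ^ 2 - ((P.q - 1) * x * Ψ.eval x) ^ 2 +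
      ((P.q - 1) * x * recCoeff a₀ p n) ^ 2 * ((Θn n).eval x * (prev Θn n).eval x) =
      (P.b₆ * (1 - P.b₁ * x) * (1 - P.b₄ * x) * (P.t - P.b₆ * x)) *
        ((1 - P.b₂ * x) * (1 - P.b₃ * x) * (P.b₆ * P.t - x)) := by
    have h1 := congrArg (fun u : ℂ[X] => u.eval x) hdet
    simp only [e₁₁, e₁₂, e₂₁, e₂₂, eval_mul, eval_add, eval_sub, eval_neg, eval_C, eval_X] at h1
    rw [← specPlus_eval, ← specMinus_eval]
    linear_combination h1
  have hco := hdet'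
  simp only [eval_eq_cubic dN, eval_eq_quadratic dΨ, eval_eq_linear dΘ, eval_eq_linear dΘ'] at hco
  obtain ⟨k₁, k₅⟩ := coeff_of_determinant hb hco
  have cN₁ : N.coeff 1 = -(1 + (P.b₁ + P.b₂ + P.b₃ + P.b₄) * P.b₆ * P.t + P.b₆ ^ 2) / 2 := by
    rw [cN₀] at k₁
    refine mul_left_cancel₀ (mul_ne_zero hb₆ ht) ?_
    linear_combination k₁ / 2
  -- Here q b₅² ≠ 1 makes Θ_n genuinely linear, hence with exactly one zero.
  have hc : (Θn n).coeff 1 ≠ 0 := by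
    rw [cΘ]
    exact neg_ne_zero.mpr (div_ne_zero (mul_ne_zero hb₆ (sub_ne_zero.mpr hqb.symm))
      (mul_ne_zero (mul_ne_zero hq0 hq') hb₅0))
  obtain ⟨lam, hlam⟩ : ∃ l, l = -(Θn n).coeff 0 / (Θn n).coeff 1 := ⟨_, rfl⟩
  have hΘ (x : ℂ) : (Θn n).eval x = (Θn n).coeff 1 * (x - lam) := by
    rw [eval_eq_linear dΘ, hlam]
    field_simp
    ring
  refine ⟨lam, fun x => ?_, fun ν μ hν hμ => ?_⟩
  · rw [hΘ, mul_eq_zero, or_iff_right hc, sub_eq_zero]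
  have hNx (x : ℂ) : 2 * (Wn n).eval x - P.W.eval x = N.eval x := by simp [hN]
  have hΨx (x : ℂ) : (Ωn n).eval x + P.V.eval x = Ψ.eval x := by simp [hΨ, add_comm]
  rw [hNx] at hν
  rw [hΨx] at hμ
  have hν' := hν
  have hμ' := hμ
  rw [eval_eq_cubic dN] at hν'
  rw [eval_eq_quadratic dΨ] at hμ'
  refine ⟨fun hl x => ?_, fun hl x => ?_, fun x => ?_, ?_⟩
  · rw [hNx, eval_eq_cubic dN]
    exact cubic_interpolation hl cN₀ cN₁ cN hν' x
  · rw [hΨx, eval_eq_quadratic dΨ]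
    exact quadratic_interpolation hl hq' hb₅0 hb₆ (sub_ne_zero.mpr hbb.symm) cN₀ cN₁ cN cΨ k₅
      hν' hμ' x
  · rw [hΘ, cΘ]
  -- At the zero of Θ_n the off-diagonal product drops out of the determinant; the six sign changes
  -- in the factors of S₊ S₋ cancel.
  · have h1 := hdet' lam
    rw [hΘ, sub_self, ← hν, ← hμ] at h1
    linear_combination h1
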